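/- **Definitions.** A *delta-matroid* $D=(E,\mathcal F)$ is a finite set $E$ with a non-empty collection $\mathcal F$ of subsets of $E$ (the feasible sets) such that for all $X,Y\in\mathcal F$ and $u\in X\bigtriangleup Y$ there is $v\in X\bigtriangleup Y$ (possibly $v=u$) with $X\bigtriangleup\{u,v\}\in\mathcal F$. The twist by $A\subseteq E$ replaces $\mathcal F$ by $\{X\bigtriangleup A: X\in\mathcal F\}$; the loop complement by $e\in E$ replaces $\mathcal F$ by $\mathcal F\bigtriangleup\{X\cup\{e\}:X\in\mathcal F,\ e\notin X\}$. $D$ is *vf-safe* if every sequence of twists and loop complements applied to $D$ yields a delta-matroid. An element $e$ of $D$ is *singular* if it is in every feasible set, or in no feasible set, or $F\bigtriangleup\{e\}\in\mathcal F$ for every $F\in\mathcal F$. A *multimatroid* $Z=(U,\Omega,r)$ is a finite set $U$, a partition $\Omega$ of $U$ into non-empty blocks (skew classes), and a function $r$ from the subtransversals (subsets of $U$ meeting each skew class at most once) to the non-negative integers, such that $r$ restricted to the subsets of any transversal is the rank function of a matroid, and $r(S\cup\{x\})+r(S\cup\{y\})-2r(S)\ge 1$ for each subtransversal $S$ and distinct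 $x,y$ in a common skew class disjoint from $S$. A subtransversal $S$ is independent if $r(S)=|S|$; a basis is a maximal independent set; a skew class is non-singular if $r(\{x\})=1$ for all its elements $x$. A near-transversal is a subtransversal meeting all but one skew class. $Z$ is *tight* if all skew classes have at least two elements and each near-transversal $S$ has a unique *slack element* $\underline{S}_Z$ in the skew class disjoint from $S$ with $r(S\cup\{\underline{S}_Z\})=r(S)$. A $q$-matroid is a multimatroid all of whose skew classes have size $q$. For $A\subseteq U$, $Z[A]$ has element set $A$, skew classes the non-empty sets $c\cap A$ with $c\in\Omega$, and the restricted rank function. For tight $Z_1,Z_2$ on disjoint sets $U_1,U_2$ with non-singular ordered skew classes $f=\{f_1<\dots<f_q\}$ of $Z_1$ and $e=\{e_1<\dots<e_q\}$ of $Z_2$, the *2-sum* $Z_1\oplus_{f=e}Z_2$ is the multimatroid whose skew classes are those of $Z_1$ and $Z_2$ other than $f$ and $e$, and whose bases are the transversals $B$ such that $B\cap U_1$ and $B\cap U_2$ are independent near-transversals of $Z_1$ and $Z_2$ with slack elements $f_i$ and $e_j$, respectively, for some $i\ne j$. If $q\geq 2$, $Z_1$ is a tight $q$-matroid all of whose skew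 classes are non-singular and ordered, and $Z_2$ is a tight multimatroid with a non-singular ordered skew class $e$ of size $q$, the *tensor product* $Z_1\otimes_e Z_2$ is obtained from $Z_1$ by taking the 2-sum, successively for every skew class $\alpha$ of $Z_1$ (in any order), along $\alpha$ and $e$ with a separate copy of $Z_2$; the element $u$ of $Z_2$ is named $u^{(\alpha)}$ in the copy for $\alpha$. For a vf-safe delta-matroid $D=(E,\mathcal F)$, $Z_{[3]}(D)$ is the unique tight 3-matroid with ordered skew classes $\{\dot e<\bar e<\hat e\}$, $e\in E$ (each denoted again by $e$), such that the bases of its restriction to $\{\dot e,\bar e:e\in E\}$ are exactly the sets $\{\dot e: e\in X\}\cup\{\bar e:e\in E\setminus X\}$ with $X\in\mathcal F$. Conversely, for a tight 3-matroid $Z$ with skew classes $\{\dot e,\bar e,\hat e\}$, $e\in E$, $D(Z)$ is the delta-matroid on $E$ whose feasible sets are the $X\subseteq E$ for which $\{\dot e: e\in X\}\cup\{\bar e:e\in E\setminus X\}$ is a basis of $Z[\{\dot e,\bar e:e\in E\}]$. For vf-safe delta-matroids $D_1,D_2$ on disjoint ground sets with non-singular elements $f,e$, respectively, $D_1\oplus_{f=e}D_2:=D(Z_{[3]}(D_1)\oplus_{f=e}Z_{[3]}(D_2))$.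 If $D_1$ and $D_2$ are vf-safe, $D_1$ has no singular elements and $e$ is a non-singular element of $D_2$, the *tensor product* $D_1\otimes_eD_2$ is obtained from $D_1$ by taking the 2-sum, successively for every element $a$ of $D_1$ (in any order), along $a$ and $e$ with a separate copy of $D_2$; the element $b$ of $D_2$ is named $b^{(a)}$ in the copy for $a$. **Proposition.** Let $D_1$ be a vf-safe delta-matroid with no singular elements, and let $D_2$ be a vf-safe delta-matroid with a non-singular element $e$. Then $D_1\otimes_e D_2$ is a well-defined vf-safe delta-matroid, the multimatroids $Z_{[3]}(D_1)$, $Z_{[3]}(D_2)$, $Z_{[3]}(D_1\otimes_e D_2)$ and $Z_{[3]}(D_1)\otimes_e Z_{[3]}(D_2)$ are well defined, and $$Z_{[3]}(D_1\otimes_e D_2)\;\cong\; Z_{[3]}(D_1)\otimes_e Z_{[3]}(D_2),$$ where the isomorphism identifies $\dot{(b^{(a)})}$ with $(\dot b)^{(a)}$, $\bar{(b^{(a)})}$ with $(\bar b)^{(a)}$, and $\hat{(b^{(a)})}$ with $(\hat b)^{(a)}$. -/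

import Mathlib

open scoped symmDiff

/-! ### Carriers

A carrier is a finite family `Ω` of nonempty, pairwise disjoint finite sets (the skew classes);
its set of elements is the union of `Ω`. -/

section Carrier

variable {α : Type*} [DecidableEq α]

/-- The set `U` of elements of a carrier with family of skew classes `Ω`. -/
def carrierGround (Ω : Finset (Finset α)) : Finset α := Ω.biUnion id

/-- A subtransversal: a set of elements meeting each skew class at most once. -/
def IsSubtransversal (Ω : Finset (Finset α)) (S : Finset α) : Prop :=
  S ⊆ carrierGround Ω ∧ ∀ c ∈ Ω, (S ∩ c).card ≤ 1

/-- A transversal: a set containing precisely one element of each skew class. -/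
def IsTransversal (Ω : Finset (Finset α)) (T : Finset α) : Prop :=
  T ⊆ carrierGround Ω ∧ ∀ c ∈ Ω, (T ∩ c).card = 1

/-- A near-transversal: a subtransversal `S` with `|S| = |Ω| - 1`. -/
def IsNearTransversal (Ω : Finset (Finset α)) (S : Finset α) : Prop :=
  IsSubtransversal Ω S ∧ S.card + 1 = Ω.card

/-- The family of nonempty traces on `A` of the skew classes. -/
def restrictClasses (Ω : Finset (Finset α)) (A : Finset α) : Finset (Finset α) :=
  (Ω.image (fun c => c ∩ A)).filter (fun c => c.Nonempty)

theorem subset_of_restrictClasses {Ω : Finset (Finset α)} {A S : Finset α}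
    (h : S ⊆ carrierGround (restrictClasses Ω A)) : S ⊆ carrierGround Ω ∩ A := by
  intro x hx
  have hx' := h hx
  simp only [carrierGround, restrictClasses, Finset.mem_biUnion, Finset.mem_filter,
    Finset.mem_image, id] at hx'
  obtain ⟨_, ⟨⟨c, hc, rfl⟩, _⟩, hxc⟩ := hx'
  rw [Finset.mem_inter] at hxc ⊢
  exact ⟨Finset.mem_biUnion.2 ⟨c, hc, hxc.1⟩, hxc.2⟩

theorem IsSubtransversal.of_restrictClasses {Ω : Finset (Finset α)} {A S : Finset α}
    (h : IsSubtransversal (restrictClasses Ω A) S) : IsSubtransversal Ω S := by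
  have hA := subset_of_restrictClasses h.1
  refine ⟨hA.trans Finset.inter_subset_left, fun c hc => ?_⟩
  have hS : S ∩ c = S ∩ (c ∩ A) := by
    ext x
    have := @hA x
    simp only [Finset.mem_inter] at this ⊢
    tauto
  rw [hS]
  by_cases hne : (c ∩ A).Nonempty
  · exact h.2 _ (Finset.mem_filter.2 ⟨Finset.mem_image_of_mem _ hc, hne⟩)
  · rw [Finset.not_nonempty_iff_eq_empty.1 hne]
    simp

theorem IsSubtransversal.exists_transversal {Ω : Finset (Finset α)} {S : Finset α}
    (hne : ∀ c ∈ Ω, c.Nonempty) (hd : (Ω : Set (Finset α)).PairwiseDisjoint id)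
    (h : IsSubtransversal Ω S) : ∃ T, IsTransversal Ω T ∧ S ⊆ T := by
  have hch : ∀ c : {c // c ∈ Ω}, ∃ x, x ∈ c.1 ∧ ∀ y ∈ S ∩ c.1, y = x := by
    rintro ⟨c, hc⟩
    by_cases hSc : (S ∩ c).Nonempty
    · obtain ⟨x, hx⟩ := hSc
      exact ⟨x, (Finset.mem_inter.1 hx).2, fun y hy =>
        Finset.card_le_one.1 (h.2 c hc) y hy x hx⟩
    · obtain ⟨x, hx⟩ := hne c hc
      exact ⟨x, hx, fun y hy => absurd ⟨y, hy⟩ hSc⟩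
  choose g hg hgS using hch
  refine ⟨Finset.univ.image g, ⟨?_, ?_⟩, ?_⟩
  · intro x hx
    obtain ⟨c, _, rfl⟩ := Finset.mem_image.1 hx
    exact Finset.mem_biUnion.2 ⟨c.1, c.2, hg c⟩
  · intro c hc
    rw [Finset.card_eq_one]
    refine ⟨g ⟨c, hc⟩, ?_⟩
    ext x
    simp only [Finset.mem_inter, Finset.mem_image, Finset.mem_univ, true_and,
      Finset.mem_singleton]
    constructor
    · rintro ⟨⟨d, rfl⟩, hxc⟩
      have hdc : d.1 = c := by
        by_contra hne'
        exact Finset.disjoint_left.1 (hd d.2 hc hne') (hg d) hxc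
      congr 1
      exact Subtype.ext hdc
    · rintro rfl
      exact ⟨⟨_, rfl⟩, hg _⟩
  · intro x hx
    obtain ⟨c, hc, hxc⟩ := Finset.mem_biUnion.1 (h.1 hx)
    exact Finset.mem_image.2 ⟨⟨c, hc⟩, Finset.mem_univ _,
      (hgS ⟨c, hc⟩ x (Finset.mem_inter.2 ⟨hx, hxc⟩)).symm⟩

end Carrier

/-! ### Multimatroids -/

/-- A multimatroid `(U, Ω, r)` with elements in `α`. The rank function is defined on
subtransversals; it is given the value `0` on all other sets, so that equality of terms is
equality of multimatroids. -/
@[ext]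
structure Multimatroid (α : Type*) [DecidableEq α] where
  /-- The family `Ω` of skew classes. -/
  classes : Finset (Finset α)
  classes_nonempty : ∀ c ∈ classes, c.Nonempty
  classes_disjoint : (classes : Set (Finset α)).PairwiseDisjoint id
  /-- The rank function. -/
  rank : Finset α → ℕ
  rank_of_not : ∀ S, ¬ IsSubtransversal classes S → rank S = 0
  /-- On the subsets of a transversal the rank function is that of a matroid. -/
  rank_matroid : ∀ T, IsTransversal classes T →
    ∃ M : Matroid α, M.E = T ∧ ∀ S : Finset α, S ⊆ T → M.eRk S = rank S
  /-- The axiom for skew pairs. -/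
  rank_skew : ∀ S, IsSubtransversal classes S → ∀ c ∈ classes, Disjoint c S →
    ∀ x ∈ c, ∀ y ∈ c, x ≠ y → 2 * rank S + 1 ≤ rank (insert x S) + rank (insert y S)

namespace Multimatroid

variable {α β : Type*} [DecidableEq α] [DecidableEq β]

/-- The set of elements of `Z`. -/
def ground (Z : Multimatroid α) : Finset α := carrierGround Z.classes

/-- An independent set: a subtransversal of nullity zero. -/
def Indep (Z : Multimatroid α) (S : Finset α) : Prop :=
  IsSubtransversal Z.classes S ∧ Z.rank S = S.card

/-- A basis: a maximal independent set. -/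
def IsBasis (Z : Multimatroid α) (B : Finset α) : Prop := Maximal Z.Indep B

/-- A set of elements (in practice a skew class) is singular if it contains an element of
rank zero. -/
def IsSingularClass (Z : Multimatroid α) (c : Finset α) : Prop := ∃ x ∈ c, Z.rank {x} = 0

/-- A multimatroid is tight if every skew class has size at least two and every near-transversal
`S` has a unique slack element in the skew class disjoint from `S`. -/
def IsTight (Z : Multimatroid α) : Prop :=
  (∀ c ∈ Z.classes, 2 ≤ c.card) ∧
    ∀ S, IsNearTransversal Z.classes S → ∀ c ∈ Z.classes, Disjoint c S →
      ∃! x, x ∈ c ∧ Z.rank (insert x S) = Z.rank S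

/-- `x` is the slack element of the near-transversal `S`. -/
def IsSlack (Z : Multimatroid α) (S : Finset α) (x : α) : Prop :=
  IsNearTransversal Z.classes S ∧
    ∃ c ∈ Z.classes, Disjoint c S ∧ x ∈ c ∧ Z.rank (insert x S) = Z.rank S

open Classical in
/-- The multimatroid `Z[A]` obtained by keeping only the elements in `A`. -/
noncomputable def restrict (Z : Multimatroid α) (A : Finset α) : Multimatroid α where
  classes := restrictClasses Z.classes A
  classes_nonempty := fun _ hc => (Finset.mem_filter.1 hc).2
  classes_disjoint := by
    intro c hc d hd hcd
    obtain ⟨c', hc', rfl⟩ := Finset.mem_image.1 (Finset.mem_filter.1 hc).1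
    obtain ⟨d', hd', rfl⟩ := Finset.mem_image.1 (Finset.mem_filter.1 hd).1
    have hne : c' ≠ d' := by
      rintro rfl
      exact hcd rfl
    exact (Z.classes_disjoint hc' hd' hne).mono Finset.inter_subset_left
      Finset.inter_subset_left
  rank := fun S => if IsSubtransversal (restrictClasses Z.classes A) S then Z.rank S else 0
  rank_of_not := fun S hS => if_neg hS
  rank_matroid := by
    intro T hT
    have hsub : ∀ S, S ⊆ T → IsSubtransversal (restrictClasses Z.classes A) S :=
      fun S hS => ⟨hS.trans hT.1, fun c hc =>
        (Finset.card_le_card (Finset.inter_subset_inter_right hS)).trans (hT.2 c hc).le⟩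
    obtain ⟨T', hT', hTT'⟩ := (hsub T subset_rfl).of_restrictClasses.exists_transversal
      Z.classes_nonempty Z.classes_disjoint
    obtain ⟨M, -, hM⟩ := Z.rank_matroid T' hT'
    refine ⟨M.restrict T, rfl, fun S hS => ?_⟩
    rw [if_pos (hsub S hS), Matroid.restrict_eRk_eq _ (by exact_mod_cast hS),
      hM S (hS.trans hTT')]
  rank_skew := by
    intro S hS c hc hcS x hx y hy hxy
    obtain ⟨c', hc', rfl⟩ := Finset.mem_image.1 (Finset.mem_filter.1 hc).1
    have hSA := subset_of_restrictClasses hS.1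
    have hins : ∀ z ∈ c' ∩ A, IsSubtransversal (restrictClasses Z.classes A) (insert z S) := by
      intro z hz
      refine ⟨Finset.insert_subset (Finset.mem_biUnion.2 ⟨_, hc, hz⟩) hS.1, fun d hd => ?_⟩
      by_cases hzd : z ∈ d
      · obtain ⟨d', hd', rfl⟩ := Finset.mem_image.1 (Finset.mem_filter.1 hd).1
        have hdc : d' = c' := by
          by_contra hne
          exact Finset.disjoint_left.1 (Z.classes_disjoint hd' hc' hne)
            (Finset.mem_inter.1 hzd).1 (Finset.mem_inter.1 hz).1
        subst hdc
        rw [Finset.insert_inter_of_mem hzd, Finset.disjoint_iff_inter_eq_empty.1 hcS.symm]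
        simp
      · rw [Finset.insert_inter_of_notMem hzd]
        exact hS.2 d hd
    have hdisj : Disjoint c' S := by
      rw [Finset.disjoint_left] at hcS ⊢
      intro z hz hzS
      exact hcS (Finset.mem_inter.2 ⟨hz, (Finset.mem_inter.1 (hSA hzS)).2⟩) hzS
    rw [if_pos hS, if_pos (hins x hx), if_pos (hins y hy)]
    exact Z.rank_skew S hS.of_restrictClasses c' hc' hdisj x (Finset.mem_inter.1 hx).1 y
      (Finset.mem_inter.1 hy).1 hxy

/-- The map `φ` on elements is an isomorphism from `Z` to `Z'`. -/
def IsIsoVia (φ : α → β) (Z : Multimatroid α) (Z' : Multimatroid β) : Prop :=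
  Set.InjOn φ (Z.ground : Set α) ∧
    Z'.classes = Z.classes.image (fun c => c.image φ) ∧
    ∀ S, IsSubtransversal Z.classes S → Z'.rank (S.image φ) = Z.rank S

/-- `x 0 < x 1 < ⋯ < x (q-1)` is a non-singular ordered skew class of `Z`. -/
def IsNonsingularOrderedClass (Z : Multimatroid α) {q : ℕ} (x : Fin q → α) : Prop :=
  Function.Injective x ∧ Finset.univ.image x ∈ Z.classes ∧
    ¬ Z.IsSingularClass (Finset.univ.image x)

/-- `Z` is the 2-sum of the tight multimatroids `Z₁` and `Z₂` (on disjoint sets of elements) along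
their non-singular ordered skew classes `x` and `y` of the same size. -/
def IsTwoSum (Z₁ : Multimatroid α) {q : ℕ} (x : Fin q → α) (Z₂ : Multimatroid α) (y : Fin q → α)
    (Z : Multimatroid α) : Prop :=
  Z₁.IsTight ∧ Z₂.IsTight ∧ Disjoint Z₁.ground Z₂.ground ∧
    Z₁.IsNonsingularOrderedClass x ∧ Z₂.IsNonsingularOrderedClass y ∧
    Z.classes = (Z₁.classes ∪ Z₂.classes) \ {Finset.univ.image x, Finset.univ.image y} ∧
    ∀ B, Z.IsBasis B ↔
      IsTransversal Z.classes B ∧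
        Z₁.Indep (B ∩ Z₁.ground) ∧ Z₂.Indep (B ∩ Z₂.ground) ∧
        ∃ i j, i ≠ j ∧ Z₁.IsSlack (B ∩ Z₁.ground) (x i) ∧ Z₂.IsSlack (B ∩ Z₂.ground) (y j)

/-- `IsTensorChain x Z₂ y l W Z`: the multimatroid `Z` arises from `W` by forming, successively for
each index `i` in the list `l`, the 2-sum along the class `x i` with the copy of `Z₂` labelled `i`,
in which an element `b` of `Z₂` is named `Sum.inr (i, b)`. -/
inductive IsTensorChain {ι : Type*} [DecidableEq ι] {q : ℕ} (x : ι → Fin q → α)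
    (Z₂ : Multimatroid β) (y : Fin q → β) :
    List ι → Multimatroid (α ⊕ (ι × β)) → Multimatroid (α ⊕ (ι × β)) → Prop
  | nil (W : Multimatroid (α ⊕ (ι × β))) : IsTensorChain x Z₂ y [] W W
  | cons (i : ι) (l : List ι) (W C W' Z : Multimatroid (α ⊕ (ι × β)))
      (hC : IsIsoVia (fun b => Sum.inr (i, b)) Z₂ C)
      (hW' : IsTwoSum W (fun k => Sum.inl (x i k)) C (fun k => Sum.inr (i, y k)) W')
      (hZ : IsTensorChain x Z₂ y l W' Z) : IsTensorChain x Z₂ y (i :: l) W Z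

/-- `Z` is the tensor product of `Z₁` and `Z₂` along the ordered skew class `y` of `Z₂`. Here `Z₁`
is a tight `q`-matroid whose skew classes are indexed by `I`, the class with index `i` being
`x i 0 < x i 1 < ⋯ < x i (q-1)`. The 2-sums may be formed in any order. The copy of the element
`b` of `Z₂` arising from the skew class with index `i` is named `Sum.inr (i, b)`. -/
def IsTensorProduct {ι : Type*} [DecidableEq ι] {q : ℕ} (Z₁ : Multimatroid α) (I : Finset ι)
    (x : ι → Fin q → α) (Z₂ : Multimatroid β) (y : Fin q → β)
    (Z : Multimatroid (α ⊕ (ι × β))) : Prop :=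
  2 ≤ q ∧ Z₁.IsTight ∧ Z₂.IsTight ∧
    (∀ i ∈ I, Z₁.IsNonsingularOrderedClass (x i)) ∧
    Set.InjOn (fun i => Finset.univ.image (x i)) (I : Set ι) ∧
    Z₁.classes = I.image (fun i => Finset.univ.image (x i)) ∧
    Z₂.IsNonsingularOrderedClass y ∧
    ∀ l : List ι, l.Nodup → l.toFinset = I →
      ∃ W, IsIsoVia Sum.inl Z₁ W ∧ IsTensorChain x Z₂ y l W Z

end Multimatroid

/-! ### Set systems and delta-matroids -/

/-- A finite ground set together with a collection of its subsets, called feasible sets. -/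
@[ext]
structure SetSystem (α : Type*) where
  /-- The ground set. -/
  ground : Finset α
  /-- The collection of feasible sets. -/
  feasible : Set (Finset α)
  subset_ground : ∀ X ∈ feasible, X ⊆ ground

namespace SetSystem

variable {α β : Type*} [DecidableEq α] [DecidableEq β]

/-- A delta-matroid: there is a feasible set, and the symmetric exchange axiom holds. -/
def IsDeltaMatroid (D : SetSystem α) : Prop :=
  D.feasible.Nonempty ∧
    ∀ X ∈ D.feasible, ∀ Y ∈ D.feasible, ∀ u ∈ X ∆ Y, ∃ v ∈ X ∆ Y, X ∆ {u, v} ∈ D.feasible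

/-- The twist `D * A`. -/
def twist (D : SetSystem α) (A : Finset α) (hA : A ⊆ D.ground) : SetSystem α where
  ground := D.ground
  feasible := {Y | ∃ X ∈ D.feasible, Y = X ∆ A}
  subset_ground := by
    rintro _ ⟨X, hX, rfl⟩ z hz
    rcases Finset.mem_symmDiff.1 hz with h | h
    · exact D.subset_ground X hX h.1
    · exact hA h.1

/-- The loop complement `D + e`. -/
def loopComplement (D : SetSystem α) (e : α) (he : e ∈ D.ground) : SetSystem α where
  ground := D.ground
  feasible := D.feasible ∆ {Y | ∃ X ∈ D.feasible, e ∉ X ∧ Y = insert e X}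
  subset_ground := by
    rintro Y (h | h)
    · exact D.subset_ground Y h.1
    · obtain ⟨X, hX, -, rfl⟩ := h.1
      exact Finset.insert_subset he (D.subset_ground X hX)

/-- `IsReachable D D'`: the set system `D'` arises from `D` by a sequence of twists and loop
complements. -/
inductive IsReachable (D : SetSystem α) : SetSystem α → Prop
  | refl : IsReachable D D
  | twist (D' : SetSystem α) (A : Finset α) (hA : A ⊆ D'.ground) (h : IsReachable D D') :
      IsReachable D (D'.twist A hA)
  | loopComplement (D' : SetSystem α) (e : α) (he : e ∈ D'.ground) (h : IsReachable D D') :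
      IsReachable D (D'.loopComplement e he)

/-- `D` is a vf-safe delta-matroid: every sequence of twists and loop complements (including the
empty one) results in a delta-matroid. -/
def IsVfSafe (D : SetSystem α) : Prop := ∀ D', IsReachable D D' → D'.IsDeltaMatroid

/-- An element `e` is singular if it is a coloop, or a loop, or `F ∆ {e}` is feasible for every
feasible set `F`. -/
def IsSingular (D : SetSystem α) (e : α) : Prop :=
  (∀ F ∈ D.feasible, e ∈ F) ∨ (∀ F ∈ D.feasible, e ∉ F) ∨ (∀ F ∈ D.feasible, F ∆ {e} ∈ D.feasible)

/-- The copy of `D` in which the element `a` is renamed `φ a`. -/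
def map (D : SetSystem α) (φ : α ↪ β) : SetSystem β where
  ground := D.ground.map φ
  feasible := {Y | ∃ X ∈ D.feasible, Y = X.map φ}
  subset_ground := by
    rintro _ ⟨X, hX, rfl⟩
    exact Finset.map_subset_map.2 (D.subset_ground X hX)

/-! ### The associated 2-matroids and tight 3-matroids

The elements of multimatroids indexed by `E` are pairs `(e, i)`: the three elements of the skew
class of `e`, usually written as `e` with a dot, a bar and a hat, are `(e, 0) < (e, 1) < (e, 2)`.
In the 2-matroids only `(e, 0)` and `(e, 1)` occur. -/

/-- `E` with dots together with `E` with bars. -/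
def dotBar (E : Finset α) : Finset (α × Fin 3) :=
  E.image (fun e => (e, 0)) ∪ E.image (fun e => (e, 1))

/-- The transversal `ω(X)`: the elements of `X` with dots and those of `E - X` with bars. -/
def omega (E X : Finset α) : Finset (α × Fin 3) :=
  X.image (fun e => (e, 0)) ∪ (E \ X).image (fun e => (e, 1))

/-- `Z` is the 2-matroid associated with `D`. -/
def IsTwoMatroidOf (D : SetSystem α) (Z : Multimatroid (α × Fin 3)) : Prop :=
  Z.classes = D.ground.image (fun e => {(e, 0), (e, 1)}) ∧
    ∀ B, Z.IsBasis B ↔ ∃ X ∈ D.feasible, B = omega D.ground X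

/-- `Z` is a tight 3-matroid indexed by `D.ground` that restricts to the 2-matroid associated with
`D` on the elements with dots or bars. -/
def IsTightThreeMatroidOf (D : SetSystem α) (Z : Multimatroid (α × Fin 3)) : Prop :=
  Z.classes = D.ground.image (fun e => {(e, 0), (e, 1), (e, 2)}) ∧ Z.IsTight ∧
    IsTwoMatroidOf D (Z.restrict (dotBar D.ground))

/-- The set system `D(Z)` of a 3-matroid `Z` indexed by a set `E`: the set `X` is feasible if and
only if `ω(X)` is a basis of the restriction of `Z` to the elements with dots or bars. -/
noncomputable def ofThreeMatroid (Z : Multimatroid (α × Fin 3)) : SetSystem α where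
  ground := Z.ground.image Prod.fst
  feasible := {X | X ⊆ Z.ground.image Prod.fst ∧
    (Z.restrict (dotBar (Z.ground.image Prod.fst))).IsBasis (omega (Z.ground.image Prod.fst) X)}
  subset_ground := fun _ hX => hX.1

/-! ### 2-sums and tensor products of vf-safe delta-matroids -/

/-- `D` is the 2-sum of the vf-safe delta-matroids `D₁` and `D₂` (with disjoint ground sets) along
their non-singular elements `f` and `e`. -/
def IsTwoSum (D₁ : SetSystem α) (f : α) (D₂ : SetSystem α) (e : α) (D : SetSystem α) : Prop :=
  D₁.IsVfSafe ∧ D₂.IsVfSafe ∧ Disjoint D₁.ground D₂.ground ∧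
    (f ∈ D₁.ground ∧ ¬ D₁.IsSingular f) ∧ (e ∈ D₂.ground ∧ ¬ D₂.IsSingular e) ∧
    ∃ Z₁ Z₂ Z, IsTightThreeMatroidOf D₁ Z₁ ∧ IsTightThreeMatroidOf D₂ Z₂ ∧
      Multimatroid.IsTwoSum Z₁ (fun k => (f, k)) Z₂ (fun k => (e, k)) Z ∧
      D = ofThreeMatroid Z

/-- The naming of the elements of the copy of `D₂` arising from the element `a` of `D₁`. -/
def copyEmbedding (a : α) : β ↪ α ⊕ (α × β) :=
  ⟨fun b => Sum.inr (a, b), fun _ _ h => (Prod.mk.inj (Sum.inr.inj h)).2⟩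

/-- `IsTensorChain D₂ e l W D`: the set system `D` arises from `W` by forming, successively for
each `a` in the list `l`, the 2-sum along `a` and `e` with the copy of `D₂` labelled `a`. -/
inductive IsTensorChain (D₂ : SetSystem β) (e : β) :
    List α → SetSystem (α ⊕ (α × β)) → SetSystem (α ⊕ (α × β)) → Prop
  | nil (W : SetSystem (α ⊕ (α × β))) : IsTensorChain D₂ e [] W W
  | cons (a : α) (l : List α) (W W' D : SetSystem (α ⊕ (α × β)))
      (hW' : IsTwoSum W (Sum.inl a) (D₂.map (copyEmbedding a)) (Sum.inr (a, e)) W')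
      (hD : IsTensorChain D₂ e l W' D) : IsTensorChain D₂ e (a :: l) W D

/-- `D` is the tensor product of the vf-safe delta-matroids `D₁`, which has no singular elements,
and `D₂` along the non-singular element `e` of `D₂`. The 2-sums may be formed in any order. The
copy of the element `b` of `D₂` arising from the element `a` of `D₁` is named `Sum.inr (a, b)`. -/
def IsTensorProduct (D₁ : SetSystem α) (D₂ : SetSystem β) (e : β)
    (D : SetSystem (α ⊕ (α × β))) : Prop :=
  D₁.IsVfSafe ∧ D₂.IsVfSafe ∧ (∀ f ∈ D₁.ground, ¬ D₁.IsSingular f) ∧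
    (e ∈ D₂.ground ∧ ¬ D₂.IsSingular e) ∧
    ∀ l : List α, l.Nodup → l.toFinset = D₁.ground →
      IsTensorChain D₂ e l (D₁.map Function.Embedding.inl) D

end SetSystem

/-- The natural identification of elements. It sends the element of the skew class of the copy
`(a, b)` of `b` arising from `a` that carries the mark `i` (dot, bar or hat) to the copy arising
from the skew class of `a` of the element of the skew class of `b` that carries the mark `i`. -/
def naturalIdentification {α β : Type*} :
    (α ⊕ (α × β)) × Fin 3 → (α × Fin 3) ⊕ (α × (β × Fin 3))
  | (Sum.inl a, i) => Sum.inl (a, i)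
  | (Sum.inr (a, b), i) => Sum.inr (a, (b, i))

/-! ### Tight tensors -/

section Tensor

open Function

variable {γ : Type*} [DecidableEq γ]

/-- A function of `w : γ → Fin 3` that depends only on the coordinates in `E`, and whose values
sum to zero along each of these coordinates. -/
structure IsBalanced (E : Finset γ) (t : (γ → Fin 3) → ZMod 2) : Prop where
  congr : ∀ w w', (∀ e ∈ E, w e = w' e) → t w = t w'
  sum_eq_zero : ∀ w, ∀ e ∈ E, t (update w e 0) + t (update w e 1) + t (update w e 2) = 0

/-- The indicator function of the set of bases of a tight 3-matroid with skew classes indexed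
by `E`. -/
structure IsTightTensor (E : Finset γ) (t : (γ → Fin 3) → ZMod 2) : Prop
    extends IsBalanced E t where
  nonzero : ∃ w, t w = 1
  exchange : ∀ w w', t w = 1 → t w' = 1 → ∀ u ∈ E, w u ≠ w' u →
    ∃ v ∈ E, w v ≠ w' v ∧ t (update (update w u (w' u)) v (w' v)) = 1

/-- Every element of the skew class of `e` belongs to a basis. -/
def IsNonsingularAt (t : (γ → Fin 3) → ZMod 2) (e : γ) : Prop := ∀ k, ∃ w, w e = k ∧ t w = 1

theorem zmod_two_eq_zero_or_one (a : ZMod 2) : a = 0 ∨ a = 1 := by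
  revert a; decide

theorem zmod_two_eq_zero_of_ne_one {a : ZMod 2} (h : a ≠ 1) : a = 0 :=
  (zmod_two_eq_zero_or_one a).resolve_right h

theorem zmod_two_eq_of_iff {a b : ZMod 2} (h : a = 1 ↔ b = 1) : a = b := by
  revert a b; decide

theorem zmod_two_triple (a b c : ZMod 2) (h : a + b + c = 0) :
    (a = 0 ∧ b = 0 ∧ c = 0) ∨ (a = 0 ∧ b = 1 ∧ c = 1) ∨ (a = 1 ∧ b = 0 ∧ c = 1) ∨
      (a = 1 ∧ b = 1 ∧ c = 0) := by
  revert a b c; decide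

theorem fin_three_triple (a : Fin 3 → ZMod 2) (h : a 0 + a 1 + a 2 = 0) :
    (∀ k, a k = 0) ∨ ∃ i, a i = 0 ∧ ∀ k, k ≠ i → a k = 1 := by
  rcases zmod_two_triple _ _ _ h with h | h | h | h
  · left; simp [Fin.forall_fin_succ, h]
  · right; exact ⟨0, by simp [Fin.forall_fin_succ, h]⟩
  · right; exact ⟨1, by simp [Fin.forall_fin_succ, h]⟩
  · right; exact ⟨2, by simp [Fin.forall_fin_succ, h]⟩

namespace IsBalanced

variable {E : Finset γ} {t : (γ → Fin 3) → ZMod 2}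

theorem exists_slack (h : IsBalanced E t) {e : γ} (he : e ∈ E) {w : γ → Fin 3} {k : Fin 3}
    (hk : t (update w e k) = 1) : ∃ i, t (update w e i) = 0 ∧
      ∀ k, k ≠ i → t (update w e k) = 1 := by
  rcases fin_three_triple (fun k => t (update w e k)) (h.sum_eq_zero w e he) with h0 | h0
  · have : t (update w e k) = 0 := h0 k
    rw [hk] at this
    exact absurd this (by decide)
  · exact h0

theorem eq_one_or_eq_one (h : IsBalanced E t) {e : γ} (he : e ∈ E) {w : γ → Fin 3} (hw : t w = 1)
    {i j : Fin 3} (hij : i ≠ j) : t (update w e i) = 1 ∨ t (update w e j) = 1 := by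
  have hk : t (update w e (w e)) = 1 := by rwa [update_eq_self]
  obtain ⟨k, -, hk'⟩ := h.exists_slack he hk
  by_cases hi : i = k
  · exact Or.inr (hk' j (fun hj => hij (hi.trans hj.symm)))
  · exact Or.inl (hk' i hi)

/-- Coordinates of a basis can be moved into prescribed pairs. -/
theorem exists_push (h : IsBalanced E t) (P : γ → Fin 3 → Prop)
    (hP : ∀ e, ∃ i j, i ≠ j ∧ P e i ∧ P e j) {w : γ → Fin 3} (hw : t w = 1) :
    ∃ w', t w' = 1 ∧ (∀ e ∈ E, P e (w' e)) ∧ ∀ e, P e (w e) → w' e = w e := by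
  have key : ∀ A : Finset γ, A ⊆ E →
      ∃ w', t w' = 1 ∧ (∀ e ∈ A, P e (w' e)) ∧ ∀ e, P e (w e) → w' e = w e := by
    intro A
    induction A using Finset.induction_on with
    | empty => exact fun _ => ⟨w, hw, by simp, fun _ _ => rfl⟩
    | insert a A ha ih =>
      intro hA
      obtain ⟨w', h1, h2, h3⟩ := ih ((Finset.subset_insert _ _).trans hA)
      by_cases hPa : P a (w' a)
      · refine ⟨w', h1, fun e he => ?_, h3⟩
        rcases Finset.mem_insert.1 he with rfl | he
        · exact hPa
        · exact h2 e he
      · obtain ⟨i, j, hij, hi, hj⟩ := hP a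
        have : ∃ k, P a k ∧ t (update w' a k) = 1 := by
          rcases h.eq_one_or_eq_one (hA (Finset.mem_insert_self _ _)) h1 hij with h | h
          · exact ⟨i, hi, h⟩
          · exact ⟨j, hj, h⟩
        obtain ⟨k, hk, hk1⟩ := this
        refine ⟨_, hk1, fun e he => ?_, fun e he => ?_⟩
        · by_cases hea : e = a
          · subst hea; simpa
          · rw [update_of_ne hea]
            exact h2 e ((Finset.mem_insert.1 he).resolve_left hea)
        · by_cases hea : e = a
          · subst hea; rw [← h3 e he] at he; exact absurd he hPa
          · rw [update_of_ne hea]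
            exact h3 e he
  exact key E subset_rfl

/-- A balanced function is determined by its values on `0-1`-vectors. -/
theorem eq_of_forall_ne_two (h : IsBalanced E t) {t' : (γ → Fin 3) → ZMod 2}
    (h' : IsBalanced E t') (heq : ∀ w, (∀ e, w e ≠ 2) → t w = t' w) : t = t' := by
  have key : ∀ A : Finset γ, A ⊆ E → ∀ w, (∀ e, e ∉ A → w e ≠ 2) → t w = t' w := by
    intro A
    induction A using Finset.induction_on with
    | empty => exact fun _ w hw => heq w (fun e => hw e (by simp))
    | insert a A ha ih =>
      intro hA w hw
      have hA' := (Finset.subset_insert _ _).trans hA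
      by_cases hwa : w a = 2
      · have h1 := h.sum_eq_zero w a (hA (Finset.mem_insert_self _ _))
        have h2 := h'.sum_eq_zero w a (hA (Finset.mem_insert_self _ _))
        have hu : ∀ k, k ≠ 2 → t (update w a k) = t' (update w a k) := by
          intro k hk
          refine ih hA' _ fun e he => ?_
          by_cases hea : e = a
          · subst hea; simpa
          · rw [update_of_ne hea]; exact hw e (by simp [hea, he])
        rw [hu 0 (by decide), hu 1 (by decide)] at h1
        rw [← hwa, update_eq_self] at h1 h2
        exact add_left_cancel (h1.trans h2.symm)
      · refine ih hA' w fun e he => ?_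
        by_cases hea : e = a
        · subst hea; exact hwa
        · exact hw e (by simp [hea, he])
  funext w
  have : ∀ w, t w = t (fun e => if e ∈ E then w e else 0) := fun w =>
    h.congr _ _ fun e he => by simp [he]
  have h2 : ∀ w, t' w = t' (fun e => if e ∈ E then w e else 0) := fun w =>
    h'.congr _ _ fun e he => by simp [he]
  rw [this, h2]
  exact key E subset_rfl _ fun e he => by simp [he]

end IsBalanced

/-! ### Contraction of tensors -/

/-- The tensor of a 2-sum. -/
def contract (t₁ : (γ → Fin 3) → ZMod 2) (f : γ) (t₂ : (γ → Fin 3) → ZMod 2) (e : γ)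
    (w : γ → Fin 3) : ZMod 2 :=
  t₁ (update w f 0) * t₂ (update w e 1) + t₁ (update w f 1) * t₂ (update w e 0)

theorem contract_comm (t₁ : (γ → Fin 3) → ZMod 2) (f : γ) (t₂ : (γ → Fin 3) → ZMod 2) (e : γ) :
    contract t₁ f t₂ e = contract t₂ e t₁ f := by
  funext w; unfold contract; ring

theorem pairing_eq_one_iff (a b : Fin 3 → ZMod 2) (ha : a 0 + a 1 + a 2 = 0)
    (hb : b 0 + b 1 + b 2 = 0) :
    a 0 * b 1 + a 1 * b 0 = 1 ↔
      (∃ k, a k = 1) ∧ (∃ k, b k = 1) ∧ ∃ i j, i ≠ j ∧ a i = 0 ∧ b j = 0 := by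
  rcases zmod_two_triple _ _ _ ha with h | h | h | h <;>
  rcases zmod_two_triple _ _ _ hb with h' | h' | h' | h' <;>
  simp [Fin.exists_fin_succ, h, h']

section Contract

variable {E₁ E₂ : Finset γ} {t₁ t₂ : (γ → Fin 3) → ZMod 2} {f e : γ}

theorem contract_eq_one_iff (h₁ : IsBalanced E₁ t₁) (h₂ : IsBalanced E₂ t₂) (hf : f ∈ E₁)
    (he : e ∈ E₂) (w : γ → Fin 3) : contract t₁ f t₂ e w = 1 ↔
      (∃ k, t₁ (update w f k) = 1) ∧ (∃ k, t₂ (update w e k) = 1) ∧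
        ∃ i j, i ≠ j ∧ t₁ (update w f i) = 0 ∧ t₂ (update w e j) = 0 :=
  pairing_eq_one_iff (fun k => t₁ (update w f k)) (fun k => t₂ (update w e k))
    (h₁.sum_eq_zero w f hf) (h₂.sum_eq_zero w e he)

theorem contract_eq_one_of (h₁ : IsBalanced E₁ t₁) (h₂ : IsBalanced E₂ t₂) (hf : f ∈ E₁)
    (he : e ∈ E₂) {w : γ → Fin 3} {j k : Fin 3} (h1 : t₁ (update w f j) = 1)
    (h2 : t₂ (update w e j) = 0) (h3 : t₂ (update w e k) = 1) :
    contract t₁ f t₂ e w = 1 := by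
  obtain ⟨i, hi, -⟩ := h₁.exists_slack hf h1
  refine (contract_eq_one_iff h₁ h₂ hf he w).2 ⟨⟨j, h1⟩, ⟨k, h3⟩, i, j, ?_, hi, h2⟩
  rintro rfl
  rw [hi] at h1
  exact absurd h1 (by decide)

theorem exists_of_contract_eq_one (h₁ : IsBalanced E₁ t₁) (h₂ : IsBalanced E₂ t₂) (hf : f ∈ E₁)
    (he : e ∈ E₂) {w : γ → Fin 3} (h : contract t₁ f t₂ e w = 1) :
    ∃ j, t₁ (update w f j) = 1 ∧ t₂ (update w e j) = 0 ∧
      ∀ k, k ≠ j → t₂ (update w e k) = 1 := by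
  obtain ⟨⟨k, hk⟩, ⟨l, hl⟩, i, j, hij, hi, hj⟩ := (contract_eq_one_iff h₁ h₂ hf he w).1 h
  obtain ⟨i', hi', hi''⟩ := h₁.exists_slack hf hk
  obtain ⟨j', hj', hj''⟩ := h₂.exists_slack he hl
  have hii : i = i' := by
    by_contra hne
    rw [hi'' i hne] at hi
    exact absurd hi (by decide)
  have hjj : j = j' := by
    by_contra hne
    rw [hj'' j hne] at hj
    exact absurd hj (by decide)
  subst hii hjj
  exact ⟨j, hi'' j hij.symm, hj', hj''⟩

theorem IsBalanced.contract (h₁ : IsBalanced E₁ t₁) (h₂ : IsBalanced E₂ t₂)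
    (hd : Disjoint E₁ E₂) :
    IsBalanced (E₁.erase f ∪ E₂.erase e) (contract t₁ f t₂ e) := by
  constructor
  · intro w w' h
    have h1 : ∀ k, t₁ (update w f k) = t₁ (update w' f k) := fun k => h₁.congr _ _ fun a ha => by
      by_cases haf : a = f
      · subst haf; simp
      · rw [update_of_ne haf, update_of_ne haf]; exact h a (by simp [ha, haf])
    have h2 : ∀ k, t₂ (update w e k) = t₂ (update w' e k) := fun k => h₂.congr _ _ fun a ha => by
      by_cases haf : a = e
      · subst haf; simp
      · rw [update_of_ne haf, update_of_ne haf]; exact h a (by simp [ha, haf])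
    simp only [_root_.contract, h1, h2]
  · intro w a ha
    simp only [_root_.contract]
    rcases Finset.mem_union.1 ha with ha | ha
    · obtain ⟨haf, ha⟩ := Finset.mem_erase.1 ha
      have h2 : ∀ i k, t₂ (update (update w a i) e k) = t₂ (update w e k) := fun i k =>
        h₂.congr _ _ fun b hb => by
          have : b ≠ a := fun hba => Finset.disjoint_left.1 hd ha (hba ▸ hb)
          simp [update_apply, this]
      simp only [h2, update_comm haf]
      linear_combination t₂ (update w e 1) * h₁.sum_eq_zero (update w f 0) a ha +
        t₂ (update w e 0) * h₁.sum_eq_zero (update w f 1) a ha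
    · obtain ⟨hae, ha⟩ := Finset.mem_erase.1 ha
      have h1 : ∀ i k, t₁ (update (update w a i) f k) = t₁ (update w f k) := fun i k =>
        h₁.congr _ _ fun b hb => by
          have : b ≠ a := fun hba => Finset.disjoint_left.1 hd hb (hba ▸ ha)
          simp [update_apply, this]
      simp only [h1, update_comm hae]
      linear_combination t₁ (update w f 0) * h₂.sum_eq_zero (update w e 1) a ha +
        t₁ (update w f 1) * h₂.sum_eq_zero (update w e 0) a ha

theorem contract_exchange (h₁ : IsTightTensor E₁ t₁) (h₂ : IsTightTensor E₂ t₂)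
    (hd : Disjoint E₁ E₂) (hf : f ∈ E₁) (he : e ∈ E₂) {w w' : γ → Fin 3}
    (hw : contract t₁ f t₂ e w = 1) (hw' : contract t₁ f t₂ e w' = 1) {u : γ}
    (hu : u ∈ E₁.erase f) (huw : w u ≠ w' u) :
    ∃ v ∈ E₁.erase f ∪ E₂.erase e, w v ≠ w' v ∧
      contract t₁ f t₂ e (update (update w u (w' u)) v (w' v)) = 1 := by
  obtain ⟨huf, huE⟩ := Finset.mem_erase.1 hu
  have hb₁ := h₁.toIsBalanced
  have hb₂ := h₂.toIsBalanced
  have hne : ∀ {a b : γ}, a ∈ E₁ → b ∈ E₂ → a ≠ b := fun ha hb hab =>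
    Finset.disjoint_left.1 hd ha (hab ▸ hb)
  obtain ⟨j, hj1, hj2, hj3⟩ := exists_of_contract_eq_one hb₁ hb₂ hf he hw
  obtain ⟨m, hm⟩ : ∃ m : Fin 3, m ≠ j := exists_ne j
  have finish : ∀ v ∈ E₁.erase f, w v ≠ w' v →
      t₁ (update (update (update w u (w' u)) v (w' v)) f j) = 1 →
      ∃ v ∈ E₁.erase f ∪ E₂.erase e, w v ≠ w' v ∧
        contract t₁ f t₂ e (update (update w u (w' u)) v (w' v)) = 1 := by
    intro v hv hvw hv1
    have h2 : ∀ k, t₂ (update (update (update w u (w' u)) v (w' v)) e k) = t₂ (update w e k) :=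
      fun k => h₂.congr _ _ fun b hb => by
        have := hne huE hb
        have := hne (Finset.mem_of_mem_erase hv) hb
        simp [update_apply, *, Ne.symm]
    exact ⟨v, Finset.mem_union_left _ hv, hvw,
      contract_eq_one_of hb₁ hb₂ hf he hv1 (by rw [h2, hj2]) (by rw [h2, hj3 m hm])⟩
  by_cases hc : t₁ (update w' f j) = 1
  · obtain ⟨v, hv, hvw, hv1⟩ := h₁.exchange _ _ hj1 hc u huE (by simpa [huf] using huw)
    have hvf : v ≠ f := by
      rintro rfl
      simp at hvw
    refine finish v (Finset.mem_erase.2 ⟨hvf, hv⟩) (by simpa [hvf] using hvw) ?_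
    rwa [update_of_ne huf, update_of_ne hvf, update_comm huf.symm, update_comm hvf.symm] at hv1
  · have hc0 := zmod_two_eq_zero_of_ne_one hc
    obtain ⟨i, hi1, hi2, hi3⟩ := exists_of_contract_eq_one hb₂ hb₁ he hf
      ((contract_comm t₁ f t₂ e) ▸ hw')
    have hij : i = j := by
      by_contra hne
      exact hc (hi3 j (Ne.symm hne))
    subst hij
    obtain ⟨v, hv, hvw, hv1⟩ := h₁.exchange _ _ hj1 (hi3 m hm) u huE (by simpa [huf] using huw)
    by_cases hvf : v = f
    · subst hvf
      rw [update_of_ne huf, update_comm huf.symm] at hv1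
      simp only [update_self, update_idem] at hv1
      by_cases hx : t₁ (update (update w u (w' u)) v i) = 1
      · refine finish u hu huw ?_
        rwa [update_idem]
      · have hx0 := zmod_two_eq_zero_of_ne_one hx
        obtain ⟨y, hy, hyw, hy1⟩ := h₂.exchange _ _ (hj3 m hm) hi1 e he (by simpa using hm)
        have hye : y ≠ e := by
          rintro rfl
          simp only [update_self, update_idem] at hy1
          rw [hj2] at hy1
          exact absurd hy1 (by decide)
        simp only [update_self, update_idem, update_of_ne hye] at hy1 hyw
        have hE₁ : ∀ k, t₁ (update (update (update w u (w' u)) y (w' y)) v k) =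
            t₁ (update (update w u (w' u)) v k) := fun k => h₁.congr _ _ fun b hb => by
          have := hne hb hy
          simp [update_apply, *]
        have hE₂ : ∀ k, t₂ (update (update (update w u (w' u)) y (w' y)) e k) =
            t₂ (update (update w e k) y (w' y)) := fun k => h₂.congr _ _ fun b hb => by
          have := (hne huE hb).symm
          simp only [update_apply, this, if_false]
          split_ifs <;> simp_all
        refine ⟨y, Finset.mem_union_right _ (Finset.mem_erase.2 ⟨hye, hy⟩), hyw, ?_⟩
        rw [contract_comm]
        exact contract_eq_one_of (k := m) hb₂ hb₁ he hf (by rw [hE₂, hy1]) (by rw [hE₁, hx0])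
          (by rw [hE₁, hv1])
    · refine finish v (Finset.mem_erase.2 ⟨hvf, hv⟩) (by simpa [hvf] using hvw) ?_
      rwa [update_of_ne huf, update_of_ne hvf, update_comm huf.symm,
        update_comm (Ne.symm hvf)] at hv1

theorem exists_contract_eq_one (h₁ : IsTightTensor E₁ t₁) (h₂ : IsTightTensor E₂ t₂)
    (hd : Disjoint E₁ E₂) (hf : f ∈ E₁) (he : e ∈ E₂) (hens : IsNonsingularAt t₂ e)
    {w : γ → Fin 3} (hw : t₁ w = 1) :
    ∃ w', (∀ a ∈ E₁, w' a = w a) ∧ contract t₁ f t₂ e w' = 1 := by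
  have hw1 : t₁ (update w f (w f)) = 1 := by rwa [update_eq_self]
  obtain ⟨i, hi, -⟩ := h₁.exists_slack hf hw1
  obtain ⟨z, hze, hz⟩ := hens i
  have hz1 : t₂ (update z e i) = 1 := by rwa [← hze, update_eq_self]
  refine ⟨fun a => if a ∈ E₁ then w a else z a, fun a ha => by simp [ha], ?_⟩
  have hE₁ : ∀ k, t₁ (update (fun a => if a ∈ E₁ then w a else z a) f k) =
      t₁ (update w f k) := fun k => h₁.congr _ _ fun b hb => by simp [update_apply, hb]
  have hE₂ : ∀ k, t₂ (update (fun a => if a ∈ E₁ then w a else z a) e k) =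
      t₂ (update z e k) := fun k => h₂.congr _ _ fun b hb => by
    simp [update_apply, Finset.disjoint_right.1 hd hb]
  rw [contract_comm]
  exact contract_eq_one_of (k := w f) h₂.toIsBalanced h₁.toIsBalanced he hf (by rw [hE₂, hz1])
    (by rw [hE₁, hi]) (by rw [hE₁, hw1])

theorem IsTightTensor.contract (h₁ : IsTightTensor E₁ t₁) (h₂ : IsTightTensor E₂ t₂)
    (hd : Disjoint E₁ E₂) (hf : f ∈ E₁) (he : e ∈ E₂) (hens : IsNonsingularAt t₂ e) :
    IsTightTensor (E₁.erase f ∪ E₂.erase e) (contract t₁ f t₂ e) where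
  toIsBalanced := h₁.toIsBalanced.contract h₂.toIsBalanced hd
  nonzero := by
    obtain ⟨w, hw⟩ := h₁.nonzero
    obtain ⟨w', -, h⟩ := exists_contract_eq_one h₁ h₂ hd hf he hens hw
    exact ⟨w', h⟩
  exchange := by
    intro w w' hw hw' u hu huw
    rcases Finset.mem_union.1 hu with hu | hu
    · exact contract_exchange h₁ h₂ hd hf he hw hw' hu huw
    · rw [contract_comm] at hw hw' ⊢
      rw [Finset.union_comm]
      exact contract_exchange h₂ h₁ hd.symm he hf hw hw' hu huw

theorem IsNonsingularAt.contract (h₁ : IsTightTensor E₁ t₁) (h₂ : IsTightTensor E₂ t₂)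
    (hd : Disjoint E₁ E₂) (hf : f ∈ E₁) (he : e ∈ E₂) (hens : IsNonsingularAt t₂ e) {a : γ}
    (ha : a ∈ E₁) (hans : IsNonsingularAt t₁ a) : IsNonsingularAt (contract t₁ f t₂ e) a := by
  intro k
  obtain ⟨w, hwk, hw⟩ := hans k
  obtain ⟨w', hw', h⟩ := exists_contract_eq_one h₁ h₂ hd hf he hens hw
  exact ⟨w', (hw' a ha).trans hwk, h⟩

end Contract

end Tensor

/-! ### Subtransversals -/

section Carrier

variable {α : Type*} [DecidableEq α] {Ω : Finset (Finset α)} {S T : Finset α}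

theorem IsSubtransversal.mono (h : IsSubtransversal Ω T) (hST : S ⊆ T) : IsSubtransversal Ω S :=
  ⟨hST.trans h.1, fun c hc =>
    (Finset.card_le_card (Finset.inter_subset_inter_right hST)).trans (h.2 c hc)⟩

theorem IsTransversal.isSubtransversal (h : IsTransversal Ω T) : IsSubtransversal Ω T :=
  ⟨h.1, fun c hc => (h.2 c hc).le⟩

theorem IsSubtransversal.insert (hd : (Ω : Set (Finset α)).PairwiseDisjoint id)
    (h : IsSubtransversal Ω S) {c : Finset α} (hc : c ∈ Ω) (hcS : Disjoint c S) {x : α}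
    (hx : x ∈ c) : IsSubtransversal Ω (insert x S) := by
  refine ⟨Finset.insert_subset (Finset.mem_biUnion.2 ⟨c, hc, hx⟩) h.1, fun d hdΩ => ?_⟩
  by_cases hxd : x ∈ d
  · have hdc : d = c := by
      by_contra hne
      exact Finset.disjoint_left.1 (hd hdΩ hc hne) hxd hx
    subst hdc
    rw [Finset.insert_inter_of_mem hxd, Finset.disjoint_iff_inter_eq_empty.1 hcS.symm]
    simp
  · rw [Finset.insert_inter_of_notMem hxd]
    exact h.2 d hdΩ

theorem IsTransversal.eq_of_subset (hT : IsTransversal Ω T) (hS : IsSubtransversal Ω S)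
    (hTS : T ⊆ S) : S = T := by
  refine (Finset.Subset.antisymm hTS fun x hx => ?_).symm
  obtain ⟨c, hc, hxc⟩ := Finset.mem_biUnion.1 (hS.1 hx)
  obtain ⟨y, hy⟩ := Finset.card_eq_one.1 (hT.2 c hc)
  have hyT : y ∈ T ∩ c := hy ▸ Finset.mem_singleton_self y
  rw [Finset.mem_inter] at hyT
  have : x = y := Finset.card_le_one.1 (hS.2 c hc) x (Finset.mem_inter.2 ⟨hx, hxc⟩) y
    (Finset.mem_inter.2 ⟨hTS hyT.1, hyT.2⟩)
  exact this ▸ hyT.1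

theorem IsTransversal.nonempty_inter (hT : IsTransversal Ω T) {c : Finset α} (hc : c ∈ Ω) :
    (T ∩ c).Nonempty := by
  rw [← Finset.card_pos, hT.2 c hc]; exact one_pos

end Carrier

namespace Multimatroid

variable {α : Type*} [DecidableEq α] {Z : Multimatroid α} {S T I : Finset α}

/-! ### Ranks and independent sets -/

theorem exists_matroid (h : IsSubtransversal Z.classes S) :
    ∃ M : Matroid α, (S : Set α) ⊆ M.E ∧ ∀ S' ⊆ S, M.eRk S' = Z.rank S' := by
  obtain ⟨T, hT, hST⟩ := h.exists_transversal Z.classes_nonempty Z.classes_disjoint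
  obtain ⟨M, hME, hM⟩ := Z.rank_matroid T hT
  exact ⟨M, by rw [hME]; exact_mod_cast hST, fun S' hS' => hM S' (hS'.trans hST)⟩

theorem rank_mono (h : IsSubtransversal Z.classes T) (hST : S ⊆ T) : Z.rank S ≤ Z.rank T := by
  obtain ⟨M, -, hM⟩ := exists_matroid h
  have := M.eRk_mono (show (S : Set α) ⊆ T by exact_mod_cast hST)
  rw [hM S hST, hM T subset_rfl] at this
  exact_mod_cast this

theorem rank_le_card (h : IsSubtransversal Z.classes S) : Z.rank S ≤ S.card := by
  obtain ⟨M, -, hM⟩ := exists_matroid h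
  have := M.eRk_le_encard (S : Set α)
  rw [hM S subset_rfl, Set.encard_coe_eq_coe_finsetCard] at this
  exact_mod_cast this

theorem rank_insert_le {x : α} (h : IsSubtransversal Z.classes (insert x S)) :
    Z.rank (insert x S) ≤ Z.rank S + 1 := by
  obtain ⟨M, -, hM⟩ := exists_matroid h
  have := M.eRk_insert_le_add_one x (S : Set α)
  rw [hM S (Finset.subset_insert _ _), ← Finset.coe_insert, hM _ subset_rfl] at this
  exact_mod_cast this

theorem indep_iff_of_eRk {M : Matroid α} (hM : ∀ S' ⊆ S, M.eRk S' = Z.rank S')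
    (h : IsSubtransversal Z.classes S) (hI : I ⊆ S) :
    Z.Indep I ↔ M.Indep (I : Set α) := by
  rw [Matroid.indep_iff_eRk_eq_encard_of_finite I.finite_toSet, hM I hI,
    Set.encard_coe_eq_coe_finsetCard]
  constructor
  · intro hI; exact_mod_cast hI.2
  · intro h'; exact ⟨h.mono hI, by exact_mod_cast h'⟩

theorem Indep.mono (h : Z.Indep T) (hST : S ⊆ T) : Z.Indep S := by
  obtain ⟨M, -, hM⟩ := exists_matroid h.1
  rw [indep_iff_of_eRk hM h.1 hST]
  exact ((indep_iff_of_eRk hM h.1 subset_rfl).1 h).subset (by exact_mod_cast hST)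

theorem Indep.exists_extend (hI : Z.Indep I) (h : IsSubtransversal Z.classes S) (hIS : I ⊆ S) :
    ∃ J, I ⊆ J ∧ J ⊆ S ∧ Z.Indep J ∧ J.card = Z.rank S := by
  obtain ⟨M, hE, hM⟩ := exists_matroid h
  obtain ⟨J, hJ, hIJ⟩ := ((indep_iff_of_eRk hM h hIS).1 hI).subset_isBasis_of_subset
    (show (I : Set α) ⊆ S by exact_mod_cast hIS) hE
  have hfin : J.Finite := S.finite_toSet.subset hJ.subset
  lift J to Finset α using hfin
  have hJS : J ⊆ S := by exact_mod_cast hJ.subset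
  refine ⟨J, by exact_mod_cast hIJ, hJS, (indep_iff_of_eRk hM h hJS).2 hJ.indep, ?_⟩
  have := hJ.encard_eq_eRk
  rw [hM S subset_rfl, Set.encard_coe_eq_coe_finsetCard] at this
  exact_mod_cast this

theorem isSubtransversal_empty : IsSubtransversal Z.classes ∅ := ⟨by simp, by simp⟩

theorem indep_empty : Z.Indep ∅ :=
  ⟨isSubtransversal_empty, le_antisymm (rank_le_card isSubtransversal_empty) (by simp)⟩

theorem Indep.insert_or_insert (h : Z.Indep S) {c : Finset α} (hc : c ∈ Z.classes)
    (hcS : Disjoint c S) {x y : α} (hx : x ∈ c) (hy : y ∈ c) (hxy : x ≠ y) :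
    Z.Indep (insert x S) ∨ Z.Indep (insert y S) := by
  have h1 := Z.rank_skew S h.1 c hc hcS x hx y hy hxy
  have hsx := h.1.insert Z.classes_disjoint hc hcS hx
  have hsy := h.1.insert Z.classes_disjoint hc hcS hy
  have hxS : x ∉ S := Finset.disjoint_left.1 hcS hx
  have hyS : y ∉ S := Finset.disjoint_left.1 hcS hy
  have h2 := rank_le_card hsx
  have h3 := rank_le_card hsy
  have h4 := h.2
  by_cases h5 : Z.rank (insert x S) = (insert x S).card
  · exact Or.inl ⟨hsx, h5⟩
  · refine Or.inr ⟨hsy, ?_⟩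
    rw [Finset.card_insert_of_notMem hxS] at h2 h5
    rw [Finset.card_insert_of_notMem hyS] at h3 ⊢
    omega

theorem rank_insert_eq_iff_of_indep (h : Z.Indep S) {c : Finset α} (hc : c ∈ Z.classes)
    (hcS : Disjoint c S) {x : α} (hx : x ∈ c) :
    Z.rank (insert x S) = Z.rank S ↔ ¬ Z.Indep (insert x S) := by
  have hsx := h.1.insert Z.classes_disjoint hc hcS hx
  have h1 := rank_insert_le hsx
  have h2 := rank_mono hsx (Finset.subset_insert x S)
  have hxS : x ∉ S := Finset.disjoint_left.1 hcS hx
  have h3 := h.2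
  unfold Indep
  rw [Finset.card_insert_of_notMem hxS]
  constructor
  · rintro h4 ⟨-, h5⟩; omega
  · intro h4
    have : Z.rank (insert x S) ≠ S.card + 1 := fun h5 => h4 ⟨hsx, h5⟩
    omega

theorem Indep.insert_of_rank_ne {x : α} (hI : Z.Indep I)
    (h : IsSubtransversal Z.classes (insert x S)) (hIS : I ⊆ S)
    (hne : Z.rank (insert x S) ≠ Z.rank S) : Z.Indep (insert x I) := by
  obtain ⟨J, hIJ, hJS, hJ, hJcard⟩ := hI.exists_extend h (hIS.trans (Finset.subset_insert _ _))
  have h1 := rank_mono h (Finset.subset_insert x S)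
  have hxJ : x ∈ J := by
    by_contra hx
    have hJS' : J ⊆ S := (Finset.subset_insert_iff_of_notMem hx).1 hJS
    have := rank_mono (h.mono (Finset.subset_insert x S)) hJS'
    rw [hJ.2] at this
    omega
  exact hJ.mono (Finset.insert_subset hxJ hIJ)

/-! ### Bases -/

theorem Indep.exists_isBasis (h : Z.Indep I) : ∃ B, I ⊆ B ∧ Z.IsBasis B := by
  have hfin : {S | Z.Indep S}.Finite :=
    (Z.ground.powerset.finite_toSet).subset fun S hS => by
      simpa using (show S ⊆ Z.ground from hS.1.1)
  obtain ⟨B, hIB, hB⟩ := hfin.exists_le_maximal h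
  exact ⟨B, hIB, hB⟩

theorem isBasis_of_isTransversal (hT : IsTransversal Z.classes T) (h : Z.Indep T) :
    Z.IsBasis T :=
  ⟨h, fun _ hS hTS => (hT.eq_of_subset hS.1 hTS).le⟩

theorem IsBasis.isTransversal (h2 : ∀ c ∈ Z.classes, 2 ≤ c.card) (h : Z.IsBasis S) :
    IsTransversal Z.classes S := by
  refine ⟨h.1.1.1, fun c hc => le_antisymm (h.1.1.2 c hc) ?_⟩
  by_contra hlt
  have hcS : Disjoint c S := by
    rw [Finset.disjoint_iff_inter_eq_empty, Finset.inter_comm, ← Finset.card_eq_zero]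
    omega
  obtain ⟨x, hx, y, hy, hxy⟩ := Finset.one_lt_card.1 (h2 c hc)
  have key : ∀ z ∈ c, ¬ Z.Indep (insert z S) := fun z hz hi =>
    Finset.disjoint_left.1 hcS hz (h.2 hi (Finset.subset_insert z S) (Finset.mem_insert_self z S))
  rcases h.1.insert_or_insert hc hcS hx hy hxy with h' | h'
  · exact key x hx h'
  · exact key y hy h'

theorem isBasis_iff (h2 : ∀ c ∈ Z.classes, 2 ≤ c.card) :
    Z.IsBasis S ↔ IsTransversal Z.classes S ∧ Z.Indep S :=
  ⟨fun h => ⟨h.isTransversal h2, h.1⟩, fun h => isBasis_of_isTransversal h.1 h.2⟩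

theorem indep_iff_exists_isBasis : Z.Indep S ↔ ∃ B, S ⊆ B ∧ Z.IsBasis B :=
  ⟨fun h => h.exists_isBasis, fun ⟨_, hSB, hB⟩ => hB.1.mono hSB⟩

theorem eq_of_indep_iff {Z' : Multimatroid α} (hc : Z.classes = Z'.classes)
    (h : ∀ S, Z.Indep S ↔ Z'.Indep S) : Z = Z' := by
  have key : ∀ {Z Z' : Multimatroid α}, Z.classes = Z'.classes →
      (∀ S, Z.Indep S ↔ Z'.Indep S) → ∀ S, Z.rank S ≤ Z'.rank S := by
    intro Z Z' hc h S
    by_cases hS : IsSubtransversal Z.classes S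
    · obtain ⟨J, -, hJS, hJ, hcard⟩ := (indep_empty (Z := Z)).exists_extend hS (by simp)
      rw [← hcard, ← ((h J).1 hJ).2]
      exact rank_mono (hc ▸ hS) hJS
    · rw [Z.rank_of_not S hS]; exact Nat.zero_le _
  ext1
  · exact hc
  · funext S
    exact le_antisymm (key hc h S) (key hc.symm (fun S => (h S).symm) S)

theorem eq_of_isBasis_iff {Z' : Multimatroid α} (hc : Z.classes = Z'.classes)
    (h : ∀ S, Z.IsBasis S ↔ Z'.IsBasis S) : Z = Z' :=
  eq_of_indep_iff hc fun S => by simp only [indep_iff_exists_isBasis, h]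

end Multimatroid

/-! ### Families of skew classes of size three -/

section Named

open Function

variable {γ δ : Type*} [DecidableEq δ]

/-- The skew class of `e`, whose elements are named by `p`. -/
def namedClass (p : γ × Fin 3 → δ) (e : γ) : Finset δ := Finset.univ.image fun k => p (e, k)

/-- The skew classes of the elements of `E`. -/
def namedClasses (p : γ × Fin 3 → δ) (E : Finset γ) : Finset (Finset δ) := E.image (namedClass p)

/-- The subtransversal that meets the skew class of `e ∈ E` in its element with mark `w e`. -/
def trace (p : γ × Fin 3 → δ) (E : Finset γ) (w : γ → Fin 3) : Finset δ :=
  E.image fun e => p (e, w e)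

variable {p : γ × Fin 3 → δ} {E E' : Finset γ} {w w' : γ → Fin 3}

theorem mem_namedClass {e : γ} {x : δ} : x ∈ namedClass p e ↔ ∃ k, p (e, k) = x := by
  simp [namedClass]

theorem mem_trace {x : δ} : x ∈ trace p E w ↔ ∃ e ∈ E, p (e, w e) = x := by
  simp [trace]

theorem trace_congr (h : ∀ e ∈ E, w e = w' e) : trace p E w = trace p E w' :=
  Finset.image_congr fun e he => by simp only [h e he]

theorem trace_mono (h : E ⊆ E') : trace p E w ⊆ trace p E' w := Finset.image_subset_image h

theorem card_trace (hp : Injective p) : (trace p E w).card = E.card :=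
  Finset.card_image_of_injective _ fun _ _ h => (Prod.mk.inj (hp h)).1

theorem card_namedClass (hp : Injective p) (e : γ) : (namedClass p e).card = 3 := by
  unfold namedClass
  rw [Finset.card_image_of_injective _ fun _ _ h => (Prod.mk.inj (hp h)).2]
  simp

theorem exists_eq_trace_of_subset {S : Finset δ} (h : S ⊆ trace p E w) :
    ∃ E' ⊆ E, S = trace p E' w := by
  obtain ⟨E', hE', rfl⟩ := Finset.subset_image_iff.1 h
  exact ⟨E', by exact_mod_cast hE', rfl⟩

theorem mem_carrierGround_namedClasses {x : δ} :
    x ∈ carrierGround (namedClasses p E) ↔ ∃ e ∈ E, ∃ k, p (e, k) = x := by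
  simp [carrierGround, namedClasses, mem_namedClass]

theorem mem_trace_iff (hp : Injective p) {e : γ} {k : Fin 3} :
    p (e, k) ∈ trace p E w ↔ e ∈ E ∧ w e = k := by
  rw [mem_trace]
  constructor
  · rintro ⟨e', he', h⟩
    obtain ⟨rfl, rfl⟩ := Prod.mk.inj (hp h)
    exact ⟨he', rfl⟩
  · rintro ⟨he, rfl⟩
    exact ⟨e, he, rfl⟩

theorem mem_namedClass_iff (hp : Injective p) {e e' : γ} {k : Fin 3} :
    p (e', k) ∈ namedClass p e ↔ e' = e := by
  rw [mem_namedClass]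
  constructor
  · rintro ⟨k', h⟩
    exact (Prod.mk.inj (hp h)).1.symm
  · rintro rfl
    exact ⟨k, rfl⟩

theorem trace_subset_trace_iff (hp : Injective p) :
    trace p E w ⊆ trace p E' w' ↔ E ⊆ E' ∧ ∀ e ∈ E, w' e = w e := by
  constructor
  · intro h
    have h' : ∀ e ∈ E, e ∈ E' ∧ w' e = w e := fun e he =>
      (mem_trace_iff hp).1 (h ((mem_trace_iff hp).2 ⟨he, rfl⟩))
    exact ⟨fun e he => (h' e he).1, fun e he => (h' e he).2⟩
  · rintro ⟨h1, h2⟩ x hx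
    obtain ⟨e, he, rfl⟩ := mem_trace.1 hx
    exact (mem_trace_iff hp).2 ⟨h1 he, h2 e he⟩

theorem disjoint_namedClass_trace_iff (hp : Injective p) {e : γ} :
    Disjoint (namedClass p e) (trace p E w) ↔ e ∉ E := by
  rw [Finset.disjoint_right]
  constructor
  · intro h he
    exact h ((mem_trace_iff hp).2 ⟨he, rfl⟩) ((mem_namedClass_iff hp).2 rfl)
  · intro h x hx hx'
    obtain ⟨e', he', rfl⟩ := mem_trace.1 hx
    exact h ((mem_namedClass_iff hp).1 hx' ▸ he')

theorem namedClass_injective (hp : Injective p) : Injective (namedClass p) := fun e e' h => by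
  have : p (e, 0) ∈ namedClass p e' := h ▸ (mem_namedClass_iff hp).2 rfl
  exact (mem_namedClass_iff hp).1 this

theorem card_namedClasses (hp : Injective p) : (namedClasses p E).card = E.card :=
  Finset.card_image_of_injective _ (namedClass_injective hp)

theorem namedClass_mem_namedClasses (hp : Injective p) {e : γ} :
    namedClass p e ∈ namedClasses p E ↔ e ∈ E := by
  simp [namedClasses, (namedClass_injective hp).eq_iff]

theorem two_le_card_of_mem_namedClasses (hp : Injective p) :
    ∀ c ∈ namedClasses p E, 2 ≤ c.card := by
  intro c hc
  obtain ⟨e, -, rfl⟩ := Finset.mem_image.1 hc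
  rw [card_namedClass hp]
  norm_num

theorem namedClasses_pairwiseDisjoint (hp : Injective p) :
    (namedClasses p E : Set (Finset δ)).PairwiseDisjoint id := by
  intro c hc d hd hcd
  obtain ⟨a, -, rfl⟩ := Finset.mem_image.1 hc
  obtain ⟨b, -, rfl⟩ := Finset.mem_image.1 hd
  rw [Function.onFun, id, id, Finset.disjoint_left]
  intro x hx hx'
  obtain ⟨k, rfl⟩ := mem_namedClass.1 hx
  exact hcd (by rw [(mem_namedClass_iff hp).1 hx'])

theorem trace_inter_namedClass (hp : Injective p) {e : γ} (he : e ∈ E) :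
    trace p E w ∩ namedClass p e = {p (e, w e)} := by
  ext x
  rw [Finset.mem_inter, Finset.mem_singleton]
  constructor
  · rintro ⟨h1, h2⟩
    obtain ⟨k, rfl⟩ := mem_namedClass.1 h2
    rw [((mem_trace_iff hp).1 h1).2]
  · rintro rfl
    exact ⟨(mem_trace_iff hp).2 ⟨he, rfl⟩, (mem_namedClass_iff hp).2 rfl⟩

theorem isTransversal_trace (hp : Injective p) :
    IsTransversal (namedClasses p E) (trace p E w) := by
  refine ⟨fun x hx => ?_, fun c hc => ?_⟩
  · obtain ⟨e, he, rfl⟩ := mem_trace.1 hx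
    exact mem_carrierGround_namedClasses.2 ⟨e, he, _, rfl⟩
  · obtain ⟨e, he, rfl⟩ := Finset.mem_image.1 hc
    rw [trace_inter_namedClass hp he, Finset.card_singleton]

theorem isSubtransversal_trace (hp : Injective p) (h : E' ⊆ E) :
    IsSubtransversal (namedClasses p E) (trace p E' w) :=
  (isTransversal_trace hp).isSubtransversal.mono (trace_mono h)

theorem exists_eq_trace_of_isTransversal (hp : Injective p) {T : Finset δ}
    (hT : IsTransversal (namedClasses p E) T) : ∃ w, T = trace p E w := by
  have : ∀ e, ∃ k, e ∈ E → p (e, k) ∈ T := by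
    intro e
    by_cases he : e ∈ E
    · obtain ⟨x, hx⟩ := hT.nonempty_inter ((namedClass_mem_namedClasses hp).2 he)
      rw [Finset.mem_inter] at hx
      obtain ⟨k, rfl⟩ := mem_namedClass.1 hx.2
      exact ⟨k, fun _ => hx.1⟩
    · exact ⟨0, fun h => absurd h he⟩
  choose w hw using this
  refine ⟨w, (isTransversal_trace hp).eq_of_subset hT.isSubtransversal fun x hx => ?_⟩
  obtain ⟨e, he, rfl⟩ := mem_trace.1 hx
  exact hw e he

theorem exists_eq_trace_of_isSubtransversal (hp : Injective p) {S : Finset δ}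
    (hS : IsSubtransversal (namedClasses p E) S) : ∃ E' ⊆ E, ∃ w, S = trace p E' w := by
  obtain ⟨T, hT, hST⟩ := hS.exists_transversal
    (fun c hc => Finset.card_pos.1 (by have := two_le_card_of_mem_namedClasses hp c hc; omega))
    (namedClasses_pairwiseDisjoint hp)
  obtain ⟨w, rfl⟩ := exists_eq_trace_of_isTransversal hp hT
  obtain ⟨E', hE', h⟩ := exists_eq_trace_of_subset hST
  exact ⟨E', hE', w, h⟩

variable [DecidableEq γ]

theorem insert_trace {e : γ} (he : e ∉ E) (k : Fin 3) :
    insert (p (e, k)) (trace p E w) = trace p (insert e E) (update w e k) := by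
  unfold trace
  rw [Finset.image_insert, update_self]
  congr 1
  refine Finset.image_congr fun a ha => ?_
  have : a ≠ e := by rintro rfl; exact he ha
  simp [this]

theorem insert_trace_erase {e : γ} (he : e ∈ E) (k : Fin 3) :
    insert (p (e, k)) (trace p (E.erase e) w) = trace p E (update w e k) := by
  rw [insert_trace (Finset.notMem_erase e E), Finset.insert_erase he]

theorem isNearTransversal_trace_erase (hp : Injective p) {e : γ} (he : e ∈ E) :
    IsNearTransversal (namedClasses p E) (trace p (E.erase e) w) := by
  refine ⟨isSubtransversal_trace hp (Finset.erase_subset _ _), ?_⟩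
  rw [card_trace hp, card_namedClasses hp, Finset.card_erase_add_one he]

end Named

/-! ### The multimatroid of a tight tensor -/

section OfTensor

open Function

variable {γ δ : Type*} [DecidableEq γ] [DecidableEq δ]

namespace IsTightTensor

variable {E : Finset γ} {t : (γ → Fin 3) → ZMod 2}

theorem exists_augment (h : IsTightTensor E t) (τ : γ → Fin 3) {I J : Finset γ} (hJE : J ⊆ E)
    (hIE : I ⊆ E) (hcard : I.card < J.card) (hI : ∃ w, t w = 1 ∧ ∀ e ∈ I, w e = τ e)
    (hJ : ∃ w, t w = 1 ∧ ∀ e ∈ J, w e = τ e) :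
    ∃ e ∈ J, e ∉ I ∧ ∃ w, t w = 1 ∧ ∀ a ∈ insert e I, w a = τ a := by
  induction hn : (I \ J).card using Nat.strong_induction_on generalizing J with
  | _ n ih =>
    obtain ⟨z, hz, hzJ⟩ := hJ
    by_cases hsub : I ⊆ J
    · obtain ⟨e, heJ, heI⟩ := Finset.exists_mem_notMem_of_card_lt_card hcard
      exact ⟨e, heJ, heI, z, hz, fun a ha => hzJ a (Finset.insert_subset heJ hsub ha)⟩
    · obtain ⟨v, hvI, hvJ⟩ := Finset.not_subset.1 hsub
      obtain ⟨w, hw, hwI⟩ := hI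
      have step : ∀ K : Finset γ, K ⊆ J → J.card ≤ K.card + 1 → I ∩ J ⊆ K →
          (∃ w, t w = 1 ∧ ∀ e ∈ insert v K, w e = τ e) →
          ∃ e ∈ J, e ∉ I ∧ ∃ w, t w = 1 ∧ ∀ a ∈ insert e I, w a = τ a := by
        intro K hKJ hKc hIK hK
        have hvK : v ∉ K := fun hv => hvJ (hKJ hv)
        have hlt : (I \ insert v K).card < n := by
          rw [← hn]
          refine Finset.card_lt_card ⟨fun x hx => ?_, fun hx => ?_⟩
          · rw [Finset.mem_sdiff, Finset.mem_insert, not_or] at hx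
            exact Finset.mem_sdiff.2 ⟨hx.1, fun hxJ =>
              hx.2.2 (hIK (Finset.mem_inter.2 ⟨hx.1, hxJ⟩))⟩
          · have := hx (Finset.mem_sdiff.2 ⟨hvI, hvJ⟩)
            simp at this
        obtain ⟨e, he, heI, hext⟩ := ih _ hlt (Finset.insert_subset (hIE hvI) (hKJ.trans hJE))
          (by rw [Finset.card_insert_of_notMem hvK]; omega) hK rfl
        refine ⟨e, ?_, heI, hext⟩
        rcases Finset.mem_insert.1 he with rfl | he
        · exact absurd hvI heI
        · exact hKJ he
      by_cases hzv : z v = τ v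
      · refine step J subset_rfl (by omega) Finset.inter_subset_right ⟨z, hz, fun e he => ?_⟩
        rcases Finset.mem_insert.1 he with rfl | he
        · exact hzv
        · exact hzJ e he
      · obtain ⟨x, hxE, hxne, hx1⟩ := h.exchange z w hz hw v (hIE hvI)
          (by rw [hwI v hvI]; exact hzv)
        refine step (J.erase x) (Finset.erase_subset _ _) ?_ ?_ ⟨_, hx1, fun e he => ?_⟩
        · have := Finset.pred_card_le_card_erase (s := J) (a := x)
          omega
        · intro a ha
          rw [Finset.mem_inter] at ha
          refine Finset.mem_erase.2 ⟨?_, ha.2⟩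
          rintro rfl
          exact hxne ((hzJ a ha.2).trans (hwI a ha.1).symm)
        · rcases Finset.mem_insert.1 he with rfl | he
          · by_cases hex : e = x
            · subst hex; rw [update_self, hwI e hvI]
            · rw [update_of_ne hex, update_self, hwI e hvI]
          · obtain ⟨hex, heJ⟩ := Finset.mem_erase.1 he
            have hev : e ≠ v := by rintro rfl; exact hvJ heJ
            rw [update_of_ne hex, update_of_ne hev, hzJ e heJ]

theorem exists_slack_of_maximal (h : IsTightTensor E t) (σ : γ → Fin 3) {e : γ} (he : e ∈ E)
    {I : Finset γ} (hIE : I ⊆ E.erase e)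
    (hmax : ∀ a ∈ E.erase e, a ∉ I → ∀ w, t w = 1 → (∀ b ∈ I, w b = σ b) → w a ≠ σ a) :
    ∃ k, ∀ w, t w = 1 → (∀ b ∈ I, w b = σ b) → w e ≠ k := by
  by_contra! hcon
  choose w hw hwI hwe using hcon
  choose ρ hρ using fun a => exists_ne (σ a)
  have key : ∀ A : Finset γ, A ⊆ E.erase e \ I → ∀ w, t w = 1 → (∀ b ∈ I, w b = σ b) →
      t (fun a => if a ∈ A then ρ a else w a) = 1 := by
    intro A
    induction A using Finset.induction_on with
    | empty => intro _ w hw _; simpa using hw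
    | insert a A ha ih =>
      intro hA w hw hwI
      have haI := Finset.mem_sdiff.1 (hA (Finset.mem_insert_self a A))
      have h1 := ih ((Finset.subset_insert _ _).trans hA) w hw hwI
      set z : γ → Fin 3 := fun a => if a ∈ A then ρ a else w a with hz
      have hzI : ∀ k, ∀ b ∈ I, update z a k b = σ b := by
        intro k b hb
        have hba : b ≠ a := by rintro rfl; exact haI.2 hb
        have hbA : b ∉ A := fun hbA =>
          (Finset.mem_sdiff.1 (hA (Finset.mem_insert_of_mem hbA))).2 hb
        rw [update_of_ne hba, hz]
        simp only [hbA, if_false]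
        exact hwI b hb
      have h2 : t (update z a (ρ a)) = 1 := by
        refine (h.eq_one_or_eq_one (Finset.mem_of_mem_erase haI.1) h1 (hρ a)).resolve_right
          fun h3 => ?_
        exact hmax a haI.1 haI.2 _ h3 (hzI _) (update_self _ _ _)
      convert h2 using 2
      funext b
      by_cases hba : b = a
      · subst hba; simp
      · simp [hz, hba]
  have hall : ∀ k, t (update (fun a => if a ∈ E.erase e \ I then ρ a else σ a) e k) = 1 := by
    intro k
    rw [← key _ subset_rfl (w k) (hw k) (hwI k)]
    refine h.congr _ _ fun a ha => ?_
    by_cases hae : a = e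
    · subst hae; simp [hwe k]
    · rw [update_of_ne hae]
      by_cases haI : a ∈ I
      · simp [haI, hwI k a haI]
      · simp [haI, hae, ha]
  have := h.sum_eq_zero (fun a => if a ∈ E.erase e \ I then ρ a else σ a) e he
  rw [hall, hall, hall] at this
  exact absurd this (by decide)

end IsTightTensor

/-- Independence of a set of elements with respect to the bases encoded by `t`. -/
def TensorIndep (p : γ × Fin 3 → δ) (E : Finset γ) (t : (γ → Fin 3) → ZMod 2) (S : Finset δ) :
    Prop := ∃ w, t w = 1 ∧ S ⊆ trace p E w

theorem tensorIndep_trace_iff {γ : Type*} {p : γ × Fin 3 → δ} (hp : Injective p) {E E' : Finset γ}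
    (hE : E' ⊆ E) {t : (γ → Fin 3) → ZMod 2} {σ : γ → Fin 3} :
    TensorIndep p E t (trace p E' σ) ↔ ∃ w, t w = 1 ∧ ∀ e ∈ E', w e = σ e := by
  simp [TensorIndep, trace_subset_trace_iff hp, hE]

open Classical in
/-- The largest size of an independent subset. -/
noncomputable def tensorRank (p : γ × Fin 3 → δ) (E : Finset γ) (t : (γ → Fin 3) → ZMod 2)
    (S : Finset δ) : ℕ := (S.powerset.filter (TensorIndep p E t)).sup Finset.card

section

variable {p : γ × Fin 3 → δ} {E : Finset γ} {t : (γ → Fin 3) → ZMod 2}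

theorem card_le_tensorRank {γ : Type*} {p : γ × Fin 3 → δ} {E : Finset γ}
    {t : (γ → Fin 3) → ZMod 2} {I S : Finset δ} (hI : TensorIndep p E t I) (hIS : I ⊆ S) :
    I.card ≤ tensorRank p E t S := by
  classical
  exact Finset.le_sup (f := Finset.card)
    (Finset.mem_filter.2 ⟨Finset.mem_powerset.2 hIS, hI⟩)

theorem exists_card_eq_tensorRank (h : IsTightTensor E t) (S : Finset δ) :
    ∃ I ⊆ S, TensorIndep p E t I ∧ I.card = tensorRank p E t S := by
  classical
  obtain ⟨w, hw⟩ := h.nonzero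
  have hne : (S.powerset.filter (TensorIndep p E t)).Nonempty :=
    ⟨∅, Finset.mem_filter.2 ⟨by simp, w, hw, by simp⟩⟩
  obtain ⟨I, hI, hcard⟩ := Finset.exists_mem_eq_sup _ hne Finset.card
  rw [Finset.mem_filter, Finset.mem_powerset] at hI
  exact ⟨I, hI.1, hI.2, hcard.symm⟩

theorem exists_matroid_of_isTightTensor (hp : Injective p) (h : IsTightTensor E t)
    (τ : γ → Fin 3) : ∃ M : Matroid δ, M.E = trace p E τ ∧
      ∀ S : Finset δ, S ⊆ trace p E τ → M.eRk S = tensorRank p E t S := by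
  let M : IndepMatroid δ := IndepMatroid.ofFinset (trace p E τ : Set δ)
    (fun I => I ⊆ trace p E τ ∧ TensorIndep p E t I)
    (by
      obtain ⟨w, hw⟩ := h.nonzero
      exact ⟨by simp, w, hw, by simp⟩)
    (by
      rintro I J ⟨hJ, w, hw, hJw⟩ hIJ
      exact ⟨hIJ.trans hJ, w, hw, hIJ.trans hJw⟩)
    (by
      rintro I J ⟨hI, hIi⟩ ⟨hJ, hJi⟩ hcard
      obtain ⟨I', hI', rfl⟩ := exists_eq_trace_of_subset hI
      obtain ⟨J', hJ', rfl⟩ := exists_eq_trace_of_subset hJ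
      rw [tensorIndep_trace_iff hp hI'] at hIi
      rw [tensorIndep_trace_iff hp hJ'] at hJi
      rw [card_trace hp, card_trace hp] at hcard
      obtain ⟨e, heJ, heI, w, hw, hwI⟩ := h.exists_augment τ hJ' hI' hcard hIi hJi
      have heq : insert (p (e, τ e)) (trace p I' τ) = trace p (insert e I') τ := by
        rw [insert_trace heI, update_eq_self]
      refine ⟨p (e, τ e), (mem_trace_iff hp).2 ⟨heJ, rfl⟩, fun h' =>
        heI ((mem_trace_iff hp).1 h').1, ?_⟩
      rw [heq]
      have hsub : insert e I' ⊆ E := Finset.insert_subset (hJ' heJ) hI'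
      exact ⟨trace_mono hsub, (tensorIndep_trace_iff hp hsub).2 ⟨w, hw, hwI⟩⟩)
    (fun I hI => by exact_mod_cast hI.1)
  have hM : ∀ I : Finset δ, M.matroid.Indep I ↔ I ⊆ trace p E τ ∧ TensorIndep p E t I := by
    intro I
    simp [M]
  refine ⟨M.matroid, rfl, fun S hS => le_antisymm ?_ ?_⟩
  · obtain ⟨J, hJ⟩ := M.matroid.exists_isBasis' (S : Set δ)
    have hfin : J.Finite := S.finite_toSet.subset hJ.subset
    lift J to Finset δ using hfin
    rw [← hJ.encard_eq_eRk, Set.encard_coe_eq_coe_finsetCard]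
    have := card_le_tensorRank ((hM J).1 hJ.indep).2 (by exact_mod_cast hJ.subset)
    exact_mod_cast this
  · obtain ⟨I, hIS, hI, hcard⟩ := exists_card_eq_tensorRank (p := p) h S
    rw [← hcard, ← Set.encard_coe_eq_coe_finsetCard,
      ← ((hM I).2 ⟨hIS.trans hS, hI⟩).eRk_eq_encard]
    exact M.matroid.eRk_mono (by exact_mod_cast hIS)

theorem tensorRank_skew (hp : Injective p) (h : IsTightTensor E t) {S : Finset δ} {e : γ}
    (he : e ∈ E) (hd : Disjoint (namedClass p e) S) {i j : Fin 3} (hij : i ≠ j) :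
    2 * tensorRank p E t S + 1 ≤
      tensorRank p E t (insert (p (e, i)) S) + tensorRank p E t (insert (p (e, j)) S) := by
  obtain ⟨I, hIS, ⟨w, hw, hIw⟩, hcard⟩ := exists_card_eq_tensorRank (p := p) h S
  have hmem : ∀ k, p (e, k) ∈ namedClass p e := fun k => (mem_namedClass_iff hp).2 rfl
  have hnot : ∀ k, p (e, k) ∉ I := fun k hk => Finset.disjoint_left.1 hd (hmem k) (hIS hk)
  have hle : ∀ k, tensorRank p E t S ≤ tensorRank p E t (insert (p (e, k)) S) := fun k => by
    rw [← hcard]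
    exact card_le_tensorRank ⟨w, hw, hIw⟩ (hIS.trans (Finset.subset_insert _ _))
  have hlt : ∀ k, t (update w e k) = 1 →
      tensorRank p E t S + 1 ≤ tensorRank p E t (insert (p (e, k)) S) := fun k hk => by
    rw [← hcard, ← Finset.card_insert_of_notMem (hnot k)]
    refine card_le_tensorRank ⟨_, hk, ?_⟩ (Finset.insert_subset_insert _ hIS)
    rw [← insert_trace_erase he]
    refine Finset.insert_subset_insert _ fun x hx => ?_
    obtain ⟨a, ha, rfl⟩ := mem_trace.1 (hIw hx)
    refine (mem_trace_iff hp).2 ⟨Finset.mem_erase.2 ⟨?_, ha⟩, rfl⟩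
    rintro rfl
    exact hnot _ hx
  have := hle i
  have := hle j
  rcases h.eq_one_or_eq_one he hw hij with h1 | h1
  · have := hlt i h1; omega
  · have := hlt j h1; omega

open Classical in
/-- The multimatroid whose bases are encoded by `t`. -/
noncomputable def Multimatroid.ofTensor (p : γ × Fin 3 → δ) (hp : Injective p) (E : Finset γ)
    (t : (γ → Fin 3) → ZMod 2) (h : IsTightTensor E t) : Multimatroid δ where
  classes := namedClasses p E
  classes_nonempty := fun c hc =>
    Finset.card_pos.1 (by have := two_le_card_of_mem_namedClasses hp c hc; omega)
  classes_disjoint := namedClasses_pairwiseDisjoint hp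
  rank := fun S => if IsSubtransversal (namedClasses p E) S then tensorRank p E t S else 0
  rank_of_not := fun S hS => if_neg hS
  rank_matroid := by
    intro T hT
    obtain ⟨τ, rfl⟩ := exists_eq_trace_of_isTransversal hp hT
    obtain ⟨M, hME, hM⟩ := exists_matroid_of_isTightTensor hp h τ
    refine ⟨M, hME, fun S hS => ?_⟩
    rw [hM S hS, if_pos (hT.isSubtransversal.mono hS)]
  rank_skew := by
    intro S hS c hc hcS x hx y hy hxy
    rw [if_pos hS, if_pos (hS.insert (namedClasses_pairwiseDisjoint hp) hc hcS hx),
      if_pos (hS.insert (namedClasses_pairwiseDisjoint hp) hc hcS hy)]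
    obtain ⟨e, he, rfl⟩ := Finset.mem_image.1 hc
    obtain ⟨i, rfl⟩ := mem_namedClass.1 hx
    obtain ⟨j, rfl⟩ := mem_namedClass.1 hy
    exact tensorRank_skew hp h he hcS (fun hij => hxy (by rw [hij]))

theorem Multimatroid.ofTensor_indep_iff {hp : Injective p} (h : IsTightTensor E t)
    {S : Finset δ} : (ofTensor p hp E t h).Indep S ↔ TensorIndep p E t S := by
  classical
  constructor
  · rintro ⟨h1, h2⟩
    have h2' : (if IsSubtransversal (namedClasses p E) S then tensorRank p E t S else 0) =
      S.card := h2
    rw [if_pos (show IsSubtransversal (namedClasses p E) S from h1)] at h2'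
    obtain ⟨I, hIS, hI, hcard⟩ := exists_card_eq_tensorRank (p := p) h S
    rwa [← Finset.eq_of_subset_of_card_le hIS (by omega)]
  · intro hS
    obtain ⟨w, hw, hSw⟩ := hS
    have h1 : IsSubtransversal (namedClasses p E) S :=
      (isTransversal_trace hp).isSubtransversal.mono hSw
    have h3 : (ofTensor p hp E t h).rank S = tensorRank p E t S := if_pos h1
    refine ⟨h1, le_antisymm (rank_le_card (Z := ofTensor p hp E t h) h1) ?_⟩
    rw [h3]
    exact card_le_tensorRank ⟨w, hw, hSw⟩ subset_rfl

end

end OfTensor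

/-! ### Tight 3-matroids and tight tensors -/

namespace Multimatroid

open Function

variable {γ δ : Type*} [DecidableEq γ] [DecidableEq δ]

/-- The skew classes of `Z` are indexed by `E`, and its bases are encoded by `t`. -/
def Represents (p : γ × Fin 3 → δ) (E : Finset γ) (t : (γ → Fin 3) → ZMod 2)
    (Z : Multimatroid δ) : Prop :=
  Z.classes = namedClasses p E ∧ ∀ w, Z.Indep (trace p E w) ↔ t w = 1

variable {p : γ × Fin 3 → δ} {E : Finset γ} {t : (γ → Fin 3) → ZMod 2} {Z Z' : Multimatroid δ}

theorem Represents.two_le_card {γ : Type*} {p : γ × Fin 3 → δ} {E : Finset γ}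
    {t : (γ → Fin 3) → ZMod 2}
    (hp : Injective p) (h : Represents p E t Z) :
    ∀ c ∈ Z.classes, 2 ≤ c.card := by
  rw [h.1]; exact two_le_card_of_mem_namedClasses hp

theorem Represents.isBasis_iff {γ : Type*} {p : γ × Fin 3 → δ} {E : Finset γ}
    {t : (γ → Fin 3) → ZMod 2}
    (hp : Injective p) (h : Represents p E t Z) {B : Finset δ} :
    Z.IsBasis B ↔ ∃ w, B = trace p E w ∧ t w = 1 := by
  rw [Multimatroid.isBasis_iff (h.two_le_card hp), h.1]
  constructor
  · rintro ⟨h1, h2⟩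
    obtain ⟨w, rfl⟩ := exists_eq_trace_of_isTransversal hp h1
    exact ⟨w, rfl, (h.2 w).1 h2⟩
  · rintro ⟨w, rfl, hw⟩
    exact ⟨isTransversal_trace hp, (h.2 w).2 hw⟩

theorem Represents.unique {γ : Type*} {p : γ × Fin 3 → δ} {E : Finset γ}
    {t : (γ → Fin 3) → ZMod 2}
    (hp : Injective p) (h : Represents p E t Z)
    (h' : Represents p E t Z') : Z = Z' :=
  eq_of_isBasis_iff (h.1.trans h'.1.symm) fun S => by rw [h.isBasis_iff hp, h'.isBasis_iff hp]

theorem Represents.indep_iff {γ : Type*} {p : γ × Fin 3 → δ} {E : Finset γ}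
    {t : (γ → Fin 3) → ZMod 2}
    (hp : Injective p) (h : Represents p E t Z) {S : Finset δ} :
    Z.Indep S ↔ ∃ w, t w = 1 ∧ S ⊆ trace p E w := by
  rw [indep_iff_exists_isBasis]
  constructor
  · rintro ⟨B, hSB, hB⟩
    obtain ⟨w, rfl, hw⟩ := (h.isBasis_iff hp).1 hB
    exact ⟨w, hw, hSB⟩
  · rintro ⟨w, hw, hS⟩
    exact ⟨_, hS, (h.isBasis_iff hp).2 ⟨w, rfl, hw⟩⟩

theorem Represents.indep_trace_iff {γ : Type*} {p : γ × Fin 3 → δ} {E : Finset γ}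
    {t : (γ → Fin 3) → ZMod 2}
    (hp : Injective p) (h : Represents p E t Z) {E' : Finset γ}
    (hE : E' ⊆ E) {σ : γ → Fin 3} :
    Z.Indep (trace p E' σ) ↔ ∃ w, t w = 1 ∧ ∀ e ∈ E', w e = σ e :=
  (h.indep_iff hp).trans (tensorIndep_trace_iff hp hE)

theorem represents_ofTensor (hp : Injective p) (h : IsTightTensor E t) :
    Represents p E t (ofTensor p hp E t h) := by
  refine ⟨rfl, fun w => ?_⟩
  rw [ofTensor_indep_iff, tensorIndep_trace_iff hp subset_rfl]
  constructor
  · rintro ⟨w', hw', heq⟩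
    rwa [← h.congr _ _ heq]
  · exact fun hw => ⟨w, hw, fun _ _ => rfl⟩

theorem Represents.isTight (hp : Injective p) (ht : IsTightTensor E t)
    (h : Represents p E t Z) : Z.IsTight := by
  refine ⟨h.two_le_card hp, fun S hS c hc hcS => ?_⟩
  have hS' := hS
  have hc' := hc
  rw [h.1] at hS' hc'
  obtain ⟨e, he, rfl⟩ := Finset.mem_image.1 hc'
  have hins : ∀ k, IsSubtransversal Z.classes (insert (p (e, k)) S) := fun k =>
    hS.1.insert Z.classes_disjoint hc hcS ((mem_namedClass_iff hp).2 rfl)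
  obtain ⟨E', hE', σ, hσ⟩ := exists_eq_trace_of_isSubtransversal hp hS'.1
  have heE' : e ∉ E' := (disjoint_namedClass_trace_iff hp).1 (hσ ▸ hcS)
  have hE'e : E' = E.erase e := by
    refine Finset.eq_of_subset_of_card_le (Finset.subset_erase.2 ⟨hE', heE'⟩) ?_
    have h2 := hS'.2
    rw [hσ, card_trace hp, card_namedClasses hp] at h2
    rw [Finset.card_erase_of_mem he]
    omega
  subst hE'e
  obtain ⟨J, -, hJS, hJ, hcard⟩ := (indep_empty (Z := Z)).exists_extend hS.1 (by simp)
  rw [hσ] at hJS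
  obtain ⟨I, hI, rfl⟩ := exists_eq_trace_of_subset hJS
  have hIE : I ⊆ E := hI.trans (Finset.erase_subset _ _)
  obtain ⟨k, hk⟩ := ht.exists_slack_of_maximal σ he hI fun a ha haI w hw hwI hwa => by
    have hi : Z.Indep (trace p (insert a I) σ) := by
      refine (h.indep_trace_iff hp (Finset.insert_subset (Finset.mem_of_mem_erase ha) hIE)).2
        ⟨w, hw, fun b hb => ?_⟩
      rcases Finset.mem_insert.1 hb with rfl | hb
      · exact hwa
      · exact hwI b hb
    have h1 := rank_mono hS.1 (S := trace p (insert a I) σ)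
      (by rw [hσ]; exact trace_mono (Finset.insert_subset ha hI))
    rw [hi.2, ← hcard, card_trace hp, card_trace hp, Finset.card_insert_of_notMem haI] at h1
    omega
  have hr : Z.rank (insert (p (e, k)) S) = Z.rank S := by
    by_contra hne
    have hi := hJ.insert_of_rank_ne (hins k) (hσ ▸ hJS) hne
    have heI : e ∉ I := fun h => heE' (hI h)
    rw [insert_trace heI, h.indep_trace_iff hp (Finset.insert_subset he hIE)] at hi
    obtain ⟨w, hw, hwI⟩ := hi
    refine hk w hw (fun b hb => ?_) (by simpa using hwI e (Finset.mem_insert_self e I))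
    have hbe : b ≠ e := by rintro rfl; exact heI hb
    simpa [hbe] using hwI b (Finset.mem_insert_of_mem hb)
  refine ⟨p (e, k), ⟨(mem_namedClass_iff hp).2 rfl, hr⟩, ?_⟩
  · rintro y ⟨hy, hyr⟩
    by_contra hne
    have := Z.rank_skew S hS.1 _ hc hcS y hy _ ((mem_namedClass_iff hp).2 rfl) hne
    omega

open Classical in
/-- The indicator function of the bases of a 3-matroid. -/
noncomputable def toTensor (p : γ × Fin 3 → δ) (E : Finset γ) (Z : Multimatroid δ)
    (w : γ → Fin 3) : ZMod 2 := if Z.Indep (trace p E w) then 1 else 0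

theorem toTensor_eq_one_iff {γ : Type*} {p : γ × Fin 3 → δ} {E : Finset γ} {w : γ → Fin 3} :
    toTensor p E Z w = 1 ↔ Z.Indep (trace p E w) := by
  unfold toTensor
  split_ifs <;> simp [*]

theorem represents_toTensor {γ : Type*} {p : γ × Fin 3 → δ} {E : Finset γ}
    (hc : Z.classes = namedClasses p E) :
    Represents p E (toTensor p E Z) Z :=
  ⟨hc, fun _ => toTensor_eq_one_iff.symm⟩

theorem isTightTensor_toTensor (hp : Injective p) (hc : Z.classes = namedClasses p E)
    (hZ : Z.IsTight) : IsTightTensor E (toTensor p E Z) where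
  congr := fun w w' h => by unfold toTensor; rw [trace_congr h]
  sum_eq_zero := by
    intro w e he
    have hce : namedClass p e ∈ Z.classes := by rwa [hc, namedClass_mem_namedClasses hp]
    have hd : Disjoint (namedClass p e) (trace p (E.erase e) w) :=
      (disjoint_namedClass_trace_iff hp).2 (Finset.notMem_erase e E)
    by_cases hS : Z.Indep (trace p (E.erase e) w)
    · obtain ⟨x, ⟨hx, hxr⟩, hu⟩ := hZ.2 _ (hc ▸ isNearTransversal_trace_erase hp he) _ hce hd
      obtain ⟨k, rfl⟩ := mem_namedClass.1 hx
      have key : ∀ i, toTensor p E Z (update w e i) = if i = k then 0 else 1 := by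
        intro i
        have hi : p (e, i) ∈ namedClass p e := (mem_namedClass_iff hp).2 rfl
        have h1 := rank_insert_eq_iff_of_indep hS hce hd hi
        rw [insert_trace_erase he] at h1
        split_ifs with hik
        · subst hik
          rw [insert_trace_erase he] at hxr
          exact if_neg (h1.1 hxr)
        · rw [toTensor_eq_one_iff]
          by_contra hn
          refine hik (Prod.mk.inj (hp (hu _ ⟨hi, ?_⟩))).2
          rw [insert_trace_erase he]
          exact h1.2 hn
      rw [key, key, key]
      fin_cases k <;> decide
    · have key : ∀ i, toTensor p E Z (update w e i) = 0 := fun i => if_neg fun h => hS <| by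
        rw [← insert_trace_erase he] at h
        exact h.mono (Finset.subset_insert _ _)
      rw [key, key, key]
      decide
  nonzero := by
    obtain ⟨B, -, hB⟩ := (indep_empty (Z := Z)).exists_isBasis
    have hT := hB.isTransversal hZ.1
    rw [hc] at hT
    obtain ⟨w, rfl⟩ := exists_eq_trace_of_isTransversal hp hT
    exact ⟨w, toTensor_eq_one_iff.2 hB.1⟩
  exchange := by
    intro w w' hw hw' u hu huw
    simp only [toTensor_eq_one_iff] at hw hw' ⊢
    set s := update w u (w' u) with hs
    by_cases hS : Z.Indep (trace p E s)
    · exact ⟨u, hu, huw, by rwa [hs, update_idem]⟩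
    have hSs : IsSubtransversal Z.classes (trace p E s) :=
      hc ▸ (isTransversal_trace hp).isSubtransversal
    have hI : Z.Indep (trace p (E.filter fun e => s e = w' e) s) := by
      refine hw'.mono ((trace_subset_trace_iff hp).2 ⟨Finset.filter_subset _ _, fun e he => ?_⟩)
      exact ((Finset.mem_filter.1 he).2).symm
    obtain ⟨J, hIJ, hJS, hJ, hcard⟩ := hI.exists_extend hSs (trace_mono (Finset.filter_subset _ _))
    obtain ⟨K, hK, rfl⟩ := exists_eq_trace_of_subset hJS
    have hrank : E.card ≤ Z.rank (trace p E s) + 1 := by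
      have h1 : trace p (E.erase u) w ⊆ trace p E s :=
        (trace_subset_trace_iff hp).2 ⟨Finset.erase_subset _ _, fun e he => by
          simp [hs, Finset.ne_of_mem_erase he]⟩
      have h2 := rank_mono hSs h1
      rw [(hw.mono (trace_mono (Finset.erase_subset u E))).2, card_trace hp] at h2
      have := Finset.card_erase_add_one hu
      omega
    have hKE : K ≠ E := by rintro rfl; exact hS hJ
    obtain ⟨v, hvE, hvK⟩ := Finset.exists_of_ssubset (hK.ssubset_of_ne hKE)
    have hKv : K = E.erase v := by
      refine Finset.eq_of_subset_of_card_le (Finset.subset_erase.2 ⟨hK, hvK⟩) ?_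
      rw [Finset.card_erase_of_mem hvE]
      rw [card_trace hp] at hcard
      omega
    have hsv : s v ≠ w' v := fun h =>
      hvK (((trace_subset_trace_iff hp).1 hIJ).1 (Finset.mem_filter.2 ⟨hvE, h⟩))
    have hvu : v ≠ u := by rintro rfl; simp [hs] at hsv
    have hwv : w v ≠ w' v := by simpa [hs, hvu] using hsv
    refine ⟨v, hvE, hwv, ?_⟩
    subst hKv
    have hmem : ∀ i, p (v, i) ∈ namedClass p v := fun i => (mem_namedClass_iff hp).2 rfl
    have := hJ.insert_or_insert (hc ▸ (namedClass_mem_namedClasses hp).2 hvE)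
      ((disjoint_namedClass_trace_iff hp).2 (Finset.notMem_erase v E)) (hmem (s v))
      (hmem (w' v)) (fun h => hsv (Prod.mk.inj (hp h)).2)
    rw [insert_trace_erase hvE, insert_trace_erase hvE, update_eq_self] at this
    exact this.resolve_left hS

end Multimatroid

/-! ### Renaming -/

section Rename

open Function

variable {γ γ' δ ε : Type*} [DecidableEq γ] [DecidableEq γ'] [DecidableEq δ] [DecidableEq ε]
  {E : Finset γ} {t : (γ → Fin 3) → ZMod 2}

theorem update_comp_embedding (g : γ ↪ γ') (w : γ' → Fin 3) (e : γ) (k : Fin 3) :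
    (fun a => update w (g e) k (g a)) = update (fun a => w (g a)) e k := by
  funext a
  simp [update_apply, g.injective.eq_iff]

theorem exists_comp_embedding {γ γ' : Type*} (g : γ ↪ γ') (w : γ → Fin 3) :
    ∃ w' : γ' → Fin 3, ∀ a, w' (g a) = w a :=
  ⟨extend g w fun _ => 0, fun a => g.injective.extend_apply _ _ a⟩

theorem IsTightTensor.map (h : IsTightTensor E t) (g : γ ↪ γ') :
    IsTightTensor (E.map g) fun w => t fun a => w (g a) where
  congr := fun w w' hw => h.congr _ _ fun e he => hw _ (Finset.mem_map_of_mem g he)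
  sum_eq_zero := by
    intro w a ha
    obtain ⟨e, he, rfl⟩ := Finset.mem_map.1 ha
    simp only [update_comp_embedding]
    exact h.sum_eq_zero _ e he
  nonzero := by
    obtain ⟨w, hw⟩ := h.nonzero
    obtain ⟨w', hw'⟩ := exists_comp_embedding g w
    exact ⟨w', by simpa only [hw'] using hw⟩
  exchange := by
    intro w w' hw hw' a ha hne
    obtain ⟨u, hu, rfl⟩ := Finset.mem_map.1 ha
    obtain ⟨v, hv, hvw, h1⟩ := h.exchange _ _ hw hw' u hu hne
    refine ⟨g v, Finset.mem_map_of_mem g hv, hvw, ?_⟩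
    simpa only [update_comp_embedding] using h1

theorem IsNonsingularAt.map {γ γ' : Type*} {t : (γ → Fin 3) → ZMod 2} {e : γ}
    (h : IsNonsingularAt t e) (g : γ ↪ γ') :
    IsNonsingularAt (fun w => t fun a => w (g a)) (g e) := by
  intro k
  obtain ⟨w, hwk, hw⟩ := h k
  obtain ⟨w', hw'⟩ := exists_comp_embedding g w
  exact ⟨w', (hw' e).trans hwk, by simpa only [hw'] using hw⟩

variable {p : γ × Fin 3 → δ} {q : γ' × Fin 3 → ε} {φ : δ → ε} {g : γ ↪ γ'}

theorem image_namedClass {γ γ' : Type*} {p : γ × Fin 3 → δ} {q : γ' × Fin 3 → ε} {g : γ ↪ γ'}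
    (hpq : ∀ e k, φ (p (e, k)) = q (g e, k)) (e : γ) :
    (namedClass p e).image φ = namedClass q (g e) := by
  unfold namedClass
  rw [Finset.image_image]
  exact Finset.image_congr fun k _ => hpq e k

theorem image_trace {γ : Type*} {E : Finset γ} {p : γ × Fin 3 → δ} {g : γ ↪ γ'}
    (hpq : ∀ e k, φ (p (e, k)) = q (g e, k)) {w : γ → Fin 3} {w' : γ' → Fin 3}
    (hw : ∀ e ∈ E, w' (g e) = w e) : (trace p E w).image φ = trace q (E.map g) w' := by
  unfold trace
  rw [Finset.image_image, Finset.map_eq_image, Finset.image_image]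
  refine Finset.image_congr fun e he => ?_
  simp only [Function.comp, hpq, hw e he]

theorem image_namedClasses {γ : Type*} {E : Finset γ} {p : γ × Fin 3 → δ} {g : γ ↪ γ'}
    (hpq : ∀ e k, φ (p (e, k)) = q (g e, k)) :
    (namedClasses p E).image (fun c => c.image φ) = namedClasses q (E.map g) := by
  unfold namedClasses
  rw [Finset.image_image, Finset.map_eq_image, Finset.image_image]
  exact Finset.image_congr fun e _ => image_namedClass hpq e

namespace Multimatroid

variable {Z : Multimatroid δ} {Z' : Multimatroid ε}

theorem IsIsoVia.represents {γ : Type*} {E : Finset γ} {t : (γ → Fin 3) → ZMod 2}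
    {p : γ × Fin 3 → δ} {g : γ ↪ γ'} (hp : Injective p) (hq : Injective q)
    (hpq : ∀ e k, φ (p (e, k)) = q (g e, k)) (h : Represents p E t Z) (hi : IsIsoVia φ Z Z') :
    Represents q (E.map g) (fun w => t fun a => w (g a)) Z' := by
  have hc : Z'.classes = namedClasses q (E.map g) := by
    rw [hi.2.1, h.1, image_namedClasses hpq]
  refine ⟨hc, fun w => ?_⟩
  have hT : IsSubtransversal Z.classes (trace p E fun a => w (g a)) :=
    h.1 ▸ (isTransversal_trace hp).isSubtransversal
  rw [← h.2 fun a => w (g a)]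
  have him := image_trace (E := E) hpq (w := fun a => w (g a)) (w' := w) fun _ _ => rfl
  have hr := hi.2.2 _ hT
  rw [him] at hr
  unfold Indep
  rw [hr, card_trace hq, card_trace hp, Finset.card_map]
  refine and_congr_left fun _ => ?_
  exact ⟨fun _ => hT, fun _ => hc ▸ (isTransversal_trace hq).isSubtransversal⟩

theorem Represents.isIsoVia {γ : Type*} {E : Finset γ} {t : (γ → Fin 3) → ZMod 2}
    {p : γ × Fin 3 → δ} {g : γ ↪ γ'} (hp : Injective p) (hq : Injective q)
    (hpq : ∀ e k, φ (p (e, k)) = q (g e, k)) (h : Represents p E t Z)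
    (h' : Represents q (E.map g) (fun w => t fun a => w (g a)) Z') : IsIsoVia φ Z Z' := by
  have hinj : Set.InjOn φ (Z.ground : Set δ) := by
    intro x hx y hy hxy
    have hx' : x ∈ carrierGround Z.classes := hx
    have hy' : y ∈ carrierGround Z.classes := hy
    rw [h.1, mem_carrierGround_namedClasses] at hx' hy'
    obtain ⟨a, -, k, rfl⟩ := hx'
    obtain ⟨b, -, l, rfl⟩ := hy'
    rw [hpq, hpq] at hxy
    obtain ⟨h1, rfl⟩ := Prod.mk.inj (hq hxy)
    rw [g.injective h1]
  have hcard : ∀ {S}, IsSubtransversal Z.classes S → (S.image φ).card = S.card := fun hS =>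
    Finset.card_image_of_injOn (hinj.mono (by exact_mod_cast hS.1))
  have himage : ∀ {S}, IsSubtransversal Z.classes S → IsSubtransversal Z'.classes (S.image φ) ∧
      (Z'.Indep (S.image φ) ↔ Z.Indep S) := by
    intro S hS
    rw [h.1] at hS
    obtain ⟨E', hE', w, rfl⟩ := exists_eq_trace_of_isSubtransversal hp hS
    obtain ⟨w', hw'⟩ := exists_comp_embedding g w
    have hE'' : E'.map g ⊆ E.map g := Finset.map_subset_map.2 hE'
    rw [image_trace hpq fun e _ => hw' e]
    refine ⟨h'.1 ▸ isSubtransversal_trace hq hE'', ?_⟩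
    rw [h'.indep_trace_iff hq hE'', h.indep_trace_iff hp hE']
    constructor
    · rintro ⟨z, hz, hzE⟩
      exact ⟨_, hz, fun e he => (hzE _ (Finset.mem_map_of_mem g he)).trans (hw' e)⟩
    · rintro ⟨z, hz, hzE⟩
      obtain ⟨z', hz'⟩ := exists_comp_embedding g z
      refine ⟨z', by simpa only [hz'] using hz, fun a ha => ?_⟩
      obtain ⟨e, he, rfl⟩ := Finset.mem_map.1 ha
      rw [hz', hw', hzE e he]
  refine ⟨hinj, by rw [h'.1, h.1, image_namedClasses hpq], fun S hS => ?_⟩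
  obtain ⟨hS', -⟩ := himage hS
  refine le_antisymm ?_ ?_
  · obtain ⟨J, -, hJS, hJ, hJc⟩ := (indep_empty (Z := Z')).exists_extend hS' (by simp)
    obtain ⟨I, hI, rfl⟩ := Finset.subset_image_iff.1 hJS
    have hIS : I ⊆ S := by exact_mod_cast hI
    have hIs := hS.mono hIS
    rw [← hJc, hcard hIs, ← ((himage hIs).2.1 hJ).2]
    exact rank_mono hS hIS
  · obtain ⟨J, -, hJS, hJ, hJc⟩ := (indep_empty (Z := Z)).exists_extend hS (by simp)
    have hJs := hS.mono hJS
    rw [← hJc, ← hcard hJs, ← ((himage hJs).2.2 hJ).2]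
    exact rank_mono hS' (Finset.image_subset_image hJS)

end Multimatroid

end Rename

/-! ### Set systems and tensors -/

section Relabel

open Function

variable {γ : Type*} [DecidableEq γ]

/-- The action of permutations of the marks. -/
def relabel (t : (γ → Fin 3) → ZMod 2) (σ : γ → Equiv.Perm (Fin 3)) (w : γ → Fin 3) : ZMod 2 :=
  t fun e => σ e (w e)

variable {E : Finset γ} {t : (γ → Fin 3) → ZMod 2}

theorem relabel_relabel {γ : Type*} (t : (γ → Fin 3) → ZMod 2) (σ τ : γ → Equiv.Perm (Fin 3)) :
    relabel (relabel t σ) τ = relabel t fun a => σ a * τ a := rfl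

theorem relabel_update (σ : γ → Equiv.Perm (Fin 3)) (w : γ → Fin 3) (e : γ) (k : Fin 3) :
    (fun a => σ a (update w e k a)) = update (fun a => σ a (w a)) e (σ e k) := by
  funext a
  by_cases h : a = e
  · subst h; simp
  · simp [h]

theorem IsBalanced.relabel (h : IsBalanced E t) (σ : γ → Equiv.Perm (Fin 3)) :
    IsBalanced E (relabel t σ) where
  congr := fun w w' hw => h.congr _ _ fun e he => by rw [hw e he]
  sum_eq_zero := by
    intro w e he
    have h1 := h.sum_eq_zero (fun a => σ a (w a)) e he
    have h2 := Equiv.sum_comp (σ e) fun k => t (update (fun a => σ a (w a)) e k)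
    rw [Fin.sum_univ_three, Fin.sum_univ_three, h1] at h2
    simp only [_root_.relabel, relabel_update]
    exact h2

theorem IsTightTensor.relabel (h : IsTightTensor E t) (σ : γ → Equiv.Perm (Fin 3)) :
    IsTightTensor E (relabel t σ) where
  toIsBalanced := h.toIsBalanced.relabel σ
  nonzero := by
    obtain ⟨w, hw⟩ := h.nonzero
    exact ⟨fun a => (σ a).symm (w a), by simpa [_root_.relabel] using hw⟩
  exchange := by
    intro w w' hw hw' u hu hne
    obtain ⟨v, hv, hvw, h1⟩ := h.exchange _ _ hw hw' u hu (fun heq => hne ((σ u).injective heq))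
    refine ⟨v, hv, fun heq => hvw (by rw [heq]), ?_⟩
    simpa only [_root_.relabel, relabel_update] using h1

/-- The `0-1`-vector of a set. -/
def indicator (X : Finset γ) (e : γ) : Fin 3 := if e ∈ X then 0 else 1

theorem indicator_ne_iff {X Y : Finset γ} {e : γ} :
    indicator X e ≠ indicator Y e ↔ e ∈ X ∆ Y := by
  unfold indicator
  rw [Finset.mem_symmDiff]
  split_ifs <;> simp [*]

theorem update_indicator_of_mem {X Y : Finset γ} {u v : γ} (hu : u ∈ X ∆ Y) (hv : v ∈ X ∆ Y) :
    update (update (indicator X) u (indicator Y u)) v (indicator Y v) =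
      indicator (X ∆ {u, v}) := by
  funext a
  rw [Finset.mem_symmDiff] at hu hv
  by_cases hav : a = v
  · subst hav
    rw [update_self]
    simp only [indicator, Finset.mem_symmDiff, Finset.mem_insert, Finset.mem_singleton]
    rcases hv with hv | hv <;> simp [hv]
  · rw [update_of_ne hav]
    by_cases hau : a = u
    · subst hau
      rw [update_self]
      simp only [indicator, Finset.mem_symmDiff, Finset.mem_insert, Finset.mem_singleton]
      rcases hu with hu | hu <;> simp [hu]
    · rw [update_of_ne hau]
      simp [indicator, Finset.mem_symmDiff, hav, hau]

theorem update_indicator_zero (X : Finset γ) (e : γ) :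
    update (indicator X) e 0 = indicator (insert e X) := by
  funext a
  by_cases h : a = e
  · subst h; simp [indicator]
  · simp [indicator, h]

theorem update_indicator_one (X : Finset γ) (e : γ) :
    update (indicator X) e 1 = indicator (X.erase e) := by
  funext a
  by_cases h : a = e
  · subst h; simp [indicator]
  · simp [indicator, h]

end Relabel

namespace SetSystem

open Function

variable {γ : Type*} [DecidableEq γ] {D D' D₀ : SetSystem γ} {t : (γ → Fin 3) → ZMod 2}

/-- The restriction of `t` to `0-1`-vectors is the indicator function of the feasible sets. -/
def Encodes (t : (γ → Fin 3) → ZMod 2) (D : SetSystem γ) : Prop :=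
  IsBalanced D.ground t ∧ ∀ X, X ∈ D.feasible ↔ X ⊆ D.ground ∧ t (indicator X) = 1

theorem Encodes.unique {D' : SetSystem γ} (h : Encodes t D) (h' : Encodes t D')
    (hg : D.ground = D'.ground) : D = D' := by
  ext1
  · exact hg
  · ext X
    rw [h.2, h'.2, hg]

theorem Encodes.tensor_unique {t' : (γ → Fin 3) → ZMod 2} (h : Encodes t D)
    (h' : Encodes t' D) : t = t' := by
  refine h.1.eq_of_forall_ne_two h'.1 fun w hw => ?_
  have heq : ∀ e ∈ D.ground, w e = indicator (D.ground.filter fun a => w a = 0) e := by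
    intro e he
    simp only [indicator, Finset.mem_filter, he, true_and]
    split_ifs with h0
    · exact h0
    · have : ∀ k : Fin 3, k ≠ 2 → k ≠ 0 → k = 1 := by decide
      exact this _ (hw e) h0
  rw [h.1.congr _ _ heq, h'.1.congr _ _ heq]
  have h1 := (h.2 (D.ground.filter fun a => w a = 0)).symm.trans
    (h'.2 (D.ground.filter fun a => w a = 0))
  simp only [Finset.filter_subset, true_and] at h1
  exact zmod_two_eq_of_iff h1

theorem exists_encodes (D : SetSystem γ) : ∃ t, Encodes t D := by
  classical
  let P : (γ → Fin 3) → Finset γ → Prop := fun w X =>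
    X ∈ D.feasible ∧ ∀ e ∈ D.ground, (w e = 0 → e ∈ X) ∧ (w e = 1 → e ∉ X)
  let N : (γ → Fin 3) → ℕ := fun w => (D.ground.powerset.filter (P w)).card
  refine ⟨fun w => (N w : ZMod 2), ⟨fun w w' h => ?_, fun w e he => ?_⟩, fun X => ?_⟩
  · have : P w = P w' := by
      funext X
      simp only [P, eq_iff_iff]
      refine and_congr_right fun _ => forall₂_congr fun e he => by rw [h e he]
    simp only [N, this]
  · have hP : ∀ X k, P (update w e k) X ↔
        P (update w e 2) X ∧ (k = 0 → e ∈ X) ∧ (k = 1 → e ∉ X) := by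
      intro X k
      simp only [P, and_assoc]
      refine and_congr_right fun _ => ⟨fun h => ⟨fun a ha => ?_, by simpa using h e he⟩,
        fun h a ha => ?_⟩
      · by_cases hae : a = e
        · subst hae; simp
        · have := h a ha
          simp only [update_of_ne hae] at this ⊢
          exact this
      · by_cases hae : a = e
        · subst hae; simpa using h.2
        · have := h.1 a ha
          simp only [update_of_ne hae] at this ⊢
          exact this
    have h0 : N (update w e 0) + N (update w e 1) = N (update w e 2) := by
      have h1 := Finset.card_filter_add_card_filter_not
        (s := D.ground.powerset.filter (P (update w e 2))) (fun X => e ∈ X)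
      rw [Finset.filter_filter, Finset.filter_filter] at h1
      simp only [N]
      rw [← h1]
      congr 2
      · exact Finset.filter_congr fun X _ => by rw [hP X 0]; simp
      · exact Finset.filter_congr fun X _ => by rw [hP X 1]; simp
    rw [← h0]
    push_cast
    generalize (N (update w e 0) : ZMod 2) = a
    generalize (N (update w e 1) : ZMod 2) = b
    revert a b
    decide
  · have hN : X ⊆ D.ground →
        D.ground.powerset.filter (P (indicator X)) = if X ∈ D.feasible then {X} else ∅ := by
      intro hX
      have hPX : ∀ Y ⊆ D.ground, P (indicator X) Y → Y = X := by
        intro Y hY hP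
        ext a
        by_cases ha : a ∈ D.ground
        · have := hP.2 a ha
          by_cases haX : a ∈ X <;> simp_all [indicator]
        · exact ⟨fun h => absurd (hY h) ha, fun h => absurd (hX h) ha⟩
      ext Y
      rw [Finset.mem_filter, Finset.mem_powerset]
      split_ifs with hF
      · rw [Finset.mem_singleton]
        refine ⟨fun h => hPX Y h.1 h.2, ?_⟩
        rintro rfl
        refine ⟨hX, hF, fun e _ => ?_⟩
        by_cases he : e ∈ Y <;> simp [indicator, he]
      · simp only [Finset.notMem_empty, iff_false, not_and]
        intro hY hP
        exact hF (hPX Y hY hP ▸ hP.1)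
    constructor
    · intro hF
      have hX := D.subset_ground X hF
      refine ⟨hX, ?_⟩
      simp only [N]
      rw [hN hX, if_pos hF]
      simp
    · rintro ⟨hX, h1⟩
      simp only [N] at h1
      rw [hN hX] at h1
      by_contra hF
      rw [if_neg hF] at h1
      simp at h1

theorem Encodes.isDeltaMatroid (h : Encodes t D) (ht : IsTightTensor D.ground t) :
    D.IsDeltaMatroid := by
  constructor
  · obtain ⟨w, hw⟩ := ht.nonzero
    obtain ⟨w', hw', hE, -⟩ := ht.exists_push (fun _ k => k = 0 ∨ k = 1)
      (fun _ => ⟨0, 1, by decide, by simp, by simp⟩) hw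
    refine ⟨D.ground.filter fun a => w' a = 0, (h.2 _).2 ⟨Finset.filter_subset _ _, ?_⟩⟩
    rw [← hw']
    refine ht.congr _ _ fun e he => ?_
    rcases hE e he with h | h <;> simp [indicator, he, h]
  · intro X hX Y hY u hu
    have hXs := D.subset_ground X hX
    have hYs := D.subset_ground Y hY
    have huE : u ∈ D.ground := by
      rcases Finset.mem_symmDiff.1 hu with hu | hu
      · exact hXs hu.1
      · exact hYs hu.1
    obtain ⟨v, hv, hvne, h1⟩ := ht.exchange _ _ ((h.2 X).1 hX).2 ((h.2 Y).1 hY).2 u huE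
      (indicator_ne_iff.2 hu)
    rw [indicator_ne_iff] at hvne
    refine ⟨v, hvne, (h.2 _).2 ⟨fun a ha => ?_, ?_⟩⟩
    · rcases Finset.mem_symmDiff.1 ha with ha | ha
      · exact hXs ha.1
      · rcases Finset.mem_insert.1 ha.1 with rfl | ha
        · exact huE
        · rw [Finset.mem_singleton] at ha
          exact ha ▸ hv
    · rw [← update_indicator_of_mem hu hvne]
      exact h1

theorem Encodes.twist (h : Encodes t D) {A : Finset γ} (hA : A ⊆ D.ground) :
    Encodes (relabel t fun e => if e ∈ A then Equiv.swap 0 1 else 1) (D.twist A hA) := by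
  refine ⟨h.1.relabel _, fun X => ?_⟩
  have hX : relabel t (fun e => if e ∈ A then Equiv.swap 0 1 else 1) (indicator X) =
      t (indicator (X ∆ A)) := by
    unfold relabel
    congr 1
    funext a
    by_cases ha : a ∈ A <;> by_cases haX : a ∈ X <;>
      simp [indicator, Finset.mem_symmDiff, ha, haX]
  rw [hX]
  have hsub : ∀ {X}, X ⊆ D.ground → X ∆ A ⊆ D.ground := fun hX a ha => by
    rcases Finset.mem_symmDiff.1 ha with ha | ha
    · exact hX ha.1
    · exact hA ha.1
  constructor
  · rintro ⟨Y, hY, rfl⟩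
    have := (h.2 Y).1 hY
    exact ⟨hsub this.1, by rw [symmDiff_symmDiff_cancel_right]; exact this.2⟩
  · rintro ⟨h1, h2⟩
    exact ⟨X ∆ A, (h.2 _).2 ⟨hsub h1, h2⟩, (symmDiff_symmDiff_cancel_right _ _).symm⟩

theorem Encodes.loopComplement (h : Encodes t D) {e : γ} (he : e ∈ D.ground) :
    Encodes (relabel t fun a => if a = e then Equiv.swap 0 2 else 1) (D.loopComplement e he) := by
  refine ⟨h.1.relabel _, fun X => ?_⟩
  have hX : (fun a => (if a = e then Equiv.swap 0 2 else 1 : Equiv.Perm (Fin 3)) (indicator X a)) =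
      if e ∈ X then update (indicator X) e 2 else indicator X := by
    funext a
    by_cases hae : a = e
    · subst hae
      by_cases haX : a ∈ X
      · simp [haX, indicator]
      · simp only [haX, if_false, if_true, indicator]
        decide
    · by_cases heX : e ∈ X <;> simp [hae, heX]
  unfold relabel
  rw [hX]
  have hmem : X ∈ (D.loopComplement e he).feasible ↔
      X ∈ D.feasible ∆ {Y | ∃ X ∈ D.feasible, e ∉ X ∧ Y = insert e X} := Iff.rfl
  have hg : (D.loopComplement e he).ground = D.ground := rfl
  rw [hmem, hg, Set.mem_symmDiff, Set.mem_ofPred_eq]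
  by_cases heX : e ∈ X
  · have h2 : (∃ Y ∈ D.feasible, e ∉ Y ∧ X = insert e Y) ↔ X.erase e ∈ D.feasible := by
      constructor
      · rintro ⟨Y, hY, heY, rfl⟩
        rwa [Finset.erase_insert heY]
      · intro hY
        exact ⟨_, hY, Finset.notMem_erase _ _, (Finset.insert_erase heX).symm⟩
    have h3 := h.1.sum_eq_zero (indicator X) e he
    rw [update_indicator_zero, update_indicator_one, Finset.insert_eq_of_mem heX] at h3
    have h4 : X.erase e ⊆ D.ground ↔ X ⊆ D.ground :=
      ⟨fun hX => by
        rw [← Finset.insert_erase heX]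
        exact Finset.insert_subset he hX, (Finset.erase_subset _ _).trans⟩
    rw [h2, h.2, h.2, h4, if_pos heX]
    by_cases hXg : X ⊆ D.ground
    · simp only [hXg, true_and]
      rcases zmod_two_triple _ _ _ h3 with h5 | h5 | h5 | h5 <;> simp [h5]
    · simp [hXg]
  · have h2 : ¬ ∃ Y ∈ D.feasible, e ∉ Y ∧ X = insert e Y := by
      rintro ⟨Y, -, -, rfl⟩
      exact heX (Finset.mem_insert_self _ _)
    rw [if_neg heX, h.2]
    simp [h2]

theorem IsReachable.encodes (h : Encodes t D) (hr : IsReachable D D') :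
    D'.ground = D.ground ∧ ∃ σ, Encodes (relabel t σ) D' := by
  induction hr with
  | refl => exact ⟨rfl, fun _ => 1, h⟩
  | twist D' A hA _ ih =>
    obtain ⟨hg, σ, hσ⟩ := ih
    exact ⟨hg, _, relabel_relabel t σ _ ▸ hσ.twist hA⟩
  | loopComplement D' e he _ ih =>
    obtain ⟨hg, σ, hσ⟩ := ih
    exact ⟨hg, _, relabel_relabel t σ _ ▸ hσ.loopComplement he⟩

theorem Encodes.isVfSafe (h : Encodes t D) (ht : IsTightTensor D.ground t) : D.IsVfSafe := by
  intro D' hr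
  obtain ⟨hg, σ, hσ⟩ := hr.encodes h
  exact hσ.isDeltaMatroid (hg ▸ ht.relabel σ)

theorem exists_isReachable_relabel_single (hr : IsReachable D₀ D) (h : Encodes t D) {e : γ}
    (he : e ∈ D.ground) (π : Equiv.Perm (Fin 3)) : ∃ D', IsReachable D₀ D' ∧
      D'.ground = D.ground ∧ Encodes (relabel t fun a => if a = e then π else 1) D' := by
  let P : Equiv.Perm (Fin 3) → Prop := fun π => ∀ (D : SetSystem γ) (t : (γ → Fin 3) → ZMod 2),
    IsReachable D₀ D → Encodes t D → e ∈ D.ground → ∃ D', IsReachable D₀ D' ∧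
      D'.ground = D.ground ∧ Encodes (relabel t fun a => if a = e then π else 1) D'
  have hs : P (Equiv.swap 0 1) := fun D t hr h he =>
    ⟨_, hr.twist D {e} (by simpa using he), rfl, by
      simpa using h.twist (A := {e}) (by simpa using he)⟩
  have hl : P (Equiv.swap 0 2) := fun D t hr h he =>
    ⟨_, hr.loopComplement D e he, rfl, h.loopComplement he⟩
  have hone : P 1 := fun D t hr h he => ⟨D, hr, rfl, by simp only [ite_self]; exact h⟩
  have hmul : ∀ π π', P π → P π' → P (π * π') := by
    intro π π' hπ hπ' D t hr h he
    obtain ⟨D₁, hr₁, hg₁, h₁⟩ := hπ D t hr h he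
    obtain ⟨D₂, hr₂, hg₂, h₂⟩ := hπ' D₁ _ hr₁ h₁ (hg₁ ▸ he)
    refine ⟨D₂, hr₂, hg₂.trans hg₁, ?_⟩
    convert h₂ using 1
    funext w
    simp only [relabel]
    congr 1
    funext a
    by_cases ha : a = e <;> simp [ha]
  have hall : ∀ π : Equiv.Perm (Fin 3), π = 1 ∨ π = Equiv.swap 0 1 ∨ π = Equiv.swap 0 2 ∨
      π = Equiv.swap 0 1 * Equiv.swap 0 2 ∨ π = Equiv.swap 0 2 * Equiv.swap 0 1 ∨
      π = Equiv.swap 0 1 * Equiv.swap 0 2 * Equiv.swap 0 1 := by decide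
  have : P π := by
    rcases hall π with rfl | rfl | rfl | rfl | rfl | rfl
    · exact hone
    · exact hs
    · exact hl
    · exact hmul _ _ hs hl
    · exact hmul _ _ hl hs
    · exact hmul _ _ (hmul _ _ hs hl) hs
  exact this D t hr h he

theorem exists_isReachable_relabel (h : Encodes t D) (σ : γ → Equiv.Perm (Fin 3)) :
    ∃ D', IsReachable D D' ∧ D'.ground = D.ground ∧
      Encodes (relabel t fun a => if a ∈ D.ground then σ a else 1) D' := by
  have key : ∀ A : Finset γ, A ⊆ D.ground → ∃ D', IsReachable D D' ∧ D'.ground = D.ground ∧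
      Encodes (relabel t fun a => if a ∈ A then σ a else 1) D' := by
    intro A
    induction A using Finset.induction_on with
    | empty => exact fun _ => ⟨D, IsReachable.refl, rfl, by
      simp only [Finset.notMem_empty, if_false]; exact h⟩
    | insert e A he ih =>
      intro hA
      obtain ⟨D₁, hr, hg, h₁⟩ := ih ((Finset.subset_insert _ _).trans hA)
      obtain ⟨D₂, hr₂, hg₂, h₂⟩ := exists_isReachable_relabel_single hr h₁
        (hg ▸ hA (Finset.mem_insert_self e A)) (σ e)
      refine ⟨D₂, hr₂, hg₂.trans hg, ?_⟩
      convert h₂ using 1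
      funext w
      simp only [relabel]
      congr 1
      funext a
      by_cases ha : a = e
      · subst ha; simp [he]
      · simp [ha]
  exact key _ subset_rfl

theorem IsVfSafe.isTightTensor (hD : D.IsVfSafe) (h : Encodes t D) :
    IsTightTensor D.ground t where
  toIsBalanced := h.1
  nonzero := by
    obtain ⟨X, hX⟩ := (hD D IsReachable.refl).1
    exact ⟨_, ((h.2 X).1 hX).2⟩
  exchange := by
    intro w w' hw hw' u hu huw
    have hperm : ∀ i j : Fin 3, ∃ π : Equiv.Perm (Fin 3), π 0 = i ∧ (j ≠ i → π 1 = j) := by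
      decide
    choose σ hσ0 hσ1 using fun a => hperm (w a) (w' a)
    obtain ⟨D', hr, hg, h'⟩ := exists_isReachable_relabel h σ
    set Y := D.ground.filter fun a => w' a = w a with hY
    have hXf : D.ground ∈ D'.feasible := by
      refine (h'.2 _).2 ⟨hg.ge, ?_⟩
      rw [← hw]
      exact h.1.congr _ _ fun a ha => by simp [ha, indicator, hσ0]
    have hYf : Y ∈ D'.feasible := by
      refine (h'.2 _).2 ⟨(Finset.filter_subset _ _).trans hg.ge, ?_⟩
      rw [← hw']
      refine h.1.congr _ _ fun a ha => ?_
      by_cases haw : w' a = w a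
      · simp [ha, indicator, hσ0, hY, haw]
      · simp [ha, indicator, hY, haw, hσ1 a haw]
    have hmem : ∀ a, a ∈ D.ground ∆ Y ↔ a ∈ D.ground ∧ w' a ≠ w a := by
      intro a
      rw [Finset.mem_symmDiff, hY, Finset.mem_filter]
      tauto
    have hu' := (hmem u).2 ⟨hu, huw.symm⟩
    obtain ⟨v, hv, h1⟩ := (hD D' hr).2 _ hXf _ hYf u hu'
    have hv' := (hmem v).1 hv
    refine ⟨v, hv'.1, hv'.2.symm, ?_⟩
    have h2 := ((h'.2 _).1 h1).2
    rw [← h2]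
    refine h.1.congr _ _ fun a ha => ?_
    by_cases hav : a = v
    · subst hav
      simp [ha, indicator, Finset.mem_symmDiff, hσ1 a hv'.2]
    · rw [update_of_ne hav]
      by_cases hau : a = u
      · subst hau
        simp [ha, indicator, Finset.mem_symmDiff, hσ1 a huw.symm]
      · simp [ha, indicator, Finset.mem_symmDiff, hav, hau, hσ0]

theorem Encodes.not_isSingular_iff (h : Encodes t D) {e : γ}
    (he : e ∈ D.ground) : ¬ D.IsSingular e ↔ IsNonsingularAt t e := by
  have hback : ∀ F, F ∈ D.feasible → t (indicator F) = 1 := fun F hF => ((h.2 F).1 hF).2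
  have hswap : ∀ F k, k ≠ 2 → indicator F e ≠ k → update (indicator F) e k =
      indicator (F ∆ {e}) := by
    intro F k hk hne
    funext a
    by_cases hae : a = e
    · subst hae
      by_cases haF : a ∈ F
      · simp only [indicator, haF, if_true, update_self, Finset.mem_symmDiff,
          Finset.mem_singleton] at hne ⊢
        revert hne hk
        fin_cases k <;> simp
      · simp only [indicator, haF, if_false, update_self, Finset.mem_symmDiff,
          Finset.mem_singleton] at hne ⊢
        revert hne hk
        fin_cases k <;> simp
    · simp [indicator, Finset.mem_symmDiff, hae]
  constructor
  · intro hns k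
    simp only [IsSingular, not_or, not_forall] at hns
    obtain ⟨⟨F₁, hF₁, he₁⟩, ⟨F₀, hF₀, he₀⟩, F₂, hF₂, hF₂'⟩ := hns
    rw [not_not] at he₀
    fin_cases k
    · exact ⟨indicator F₀, by simp [indicator, he₀], hback _ hF₀⟩
    · exact ⟨indicator F₁, by simp [indicator, he₁], hback _ hF₁⟩
    · obtain ⟨k, hk2, hk⟩ : ∃ k : Fin 3, k ≠ 2 ∧ indicator F₂ e ≠ k := by
        by_cases heF : e ∈ F₂
        · exact ⟨1, by decide, by simp [indicator, heF]⟩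
        · exact ⟨0, by decide, by simp [indicator, heF]⟩
      refine ⟨update (indicator F₂) e 2, by simp, ?_⟩
      refine (h.1.eq_one_or_eq_one he (hback _ hF₂) hk2).resolve_left fun h1 => hF₂' ?_
      rw [hswap F₂ k hk2 hk] at h1
      refine (h.2 _).2 ⟨fun a ha => ?_, h1⟩
      rcases Finset.mem_symmDiff.1 ha with ha | ha
      · exact D.subset_ground _ hF₂ ha.1
      · exact (Finset.mem_singleton.1 ha.1) ▸ he
  · intro hns
    have hpush : ∀ k, ∃ F ⊆ D.ground, t (update (indicator F) e k) = 1 := by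
      intro k
      obtain ⟨w, hwk, hw⟩ := hns k
      obtain ⟨w', hw', hE, hfix⟩ := h.1.exists_push
        (fun a i => if a = e then i = k ∨ i ≠ k else i = 0 ∨ i = 1)
        (fun a => by
          by_cases hae : a = e
          · exact ⟨0, 1, by decide, by simp [hae, em], by simp [hae, em]⟩
          · exact ⟨0, 1, by decide, by simp [hae], by simp [hae]⟩) hw
      have hwe : w' e = k := by rw [hfix e (by simp [em]), hwk]
      refine ⟨D.ground.filter fun a => w' a = 0, Finset.filter_subset _ _, ?_⟩
      rw [← hw']
      refine h.1.congr _ _ fun a ha => ?_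
      by_cases hae : a = e
      · subst hae; simp [hwe]
      · have := hE a ha
        rw [if_neg hae] at this
        rcases this with h | h <;> simp [indicator, ha, hae, h]
    rintro (hs | hs | hs)
    · obtain ⟨F, hF, h1⟩ := hpush 1
      rw [update_indicator_one] at h1
      have := hs _ ((h.2 _).2 ⟨(Finset.erase_subset _ _).trans hF, h1⟩)
      simp at this
    · obtain ⟨F, hF, h1⟩ := hpush 0
      rw [update_indicator_zero] at h1
      have := hs _ ((h.2 _).2 ⟨Finset.insert_subset he hF, h1⟩)
      simp at this
    · obtain ⟨F, hF, h1⟩ := hpush 2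
      have h3 := h.1.sum_eq_zero (indicator F) e he
      rw [h1, update_indicator_zero, update_indicator_one] at h3
      have hiff : insert e F ∈ D.feasible ↔ F.erase e ∈ D.feasible := by
        have e1 : insert e F ∆ {e} = F.erase e := by
          ext a; by_cases a = e <;> simp_all [Finset.mem_symmDiff]
        have e2 : F.erase e ∆ {e} = insert e F := by
          ext a; by_cases a = e <;> simp_all [Finset.mem_symmDiff]
        exact ⟨fun hf => e1 ▸ hs _ hf, fun hf => e2 ▸ hs _ hf⟩
      rw [h.2, h.2] at hiff
      simp only [Finset.insert_subset he hF, (Finset.erase_subset e F).trans hF, true_and] at hiff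
      rcases zmod_two_triple _ _ _ h3 with h5 | h5 | h5 | h5 <;> simp_all

end SetSystem

/-! ### The tight 3-matroid of a vf-safe delta-matroid -/

section ThreeMatroid

open Function Multimatroid

variable {γ : Type*} [DecidableEq γ] {E : Finset γ} {t : (γ → Fin 3) → ZMod 2}
  {Z : Multimatroid (γ × Fin 3)}

theorem namedClasses_id (E : Finset γ) :
    namedClasses id E = E.image fun e => {(e, 0), (e, 1), (e, 2)} := by
  unfold namedClasses
  refine Finset.image_congr fun e _ => ?_
  ext ⟨a, k⟩
  simp only [mem_namedClass, id, Prod.mk.injEq, Finset.mem_insert, Finset.mem_singleton]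
  fin_cases k <;> simp [eq_comm]

theorem namedClass_inter_dotBar {e : γ} (he : e ∈ E) :
    namedClass id e ∩ SetSystem.dotBar E = {(e, 0), (e, 1)} := by
  ext ⟨a, k⟩
  simp only [mem_namedClass, SetSystem.dotBar, id, Finset.mem_inter, Finset.mem_union,
    Finset.mem_image, Prod.mk.injEq, Finset.mem_insert, Finset.mem_singleton]
  constructor
  · rintro ⟨⟨k', rfl, rfl⟩, ⟨b, -, rfl, rfl⟩ | ⟨b, -, rfl, rfl⟩⟩ <;> simp
  · rintro (⟨rfl, rfl⟩ | ⟨rfl, rfl⟩) <;> simp [he]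

theorem restrictClasses_dotBar (E : Finset γ) :
    restrictClasses (namedClasses id E) (SetSystem.dotBar E) =
      E.image fun e => {(e, 0), (e, 1)} := by
  unfold restrictClasses namedClasses
  rw [Finset.image_image, Finset.filter_true_of_mem]
  · exact Finset.image_congr fun e he => namedClass_inter_dotBar he
  · intro c hc
    obtain ⟨e, he, rfl⟩ := Finset.mem_image.1 hc
    rw [Function.comp, namedClass_inter_dotBar he]
    simp

theorem omega_eq_trace {X : Finset γ} (hX : X ⊆ E) :
    SetSystem.omega E X = trace id E (indicator X) := by
  ext ⟨a, k⟩
  rw [show (a, k) ∈ trace id E (indicator X) ↔ a ∈ E ∧ indicator X a = k from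
    mem_trace_iff injective_id]
  simp only [SetSystem.omega, Finset.mem_union, Finset.mem_image, Finset.mem_sdiff, Prod.mk.injEq,
    indicator]
  constructor
  · rintro (⟨b, hb, rfl, rfl⟩ | ⟨b, hb, rfl, rfl⟩)
    · simp [hb, hX hb]
    · simp [hb]
  · rintro ⟨ha, rfl⟩
    by_cases haX : a ∈ X <;> simp [ha, haX]

theorem Multimatroid.restrict_indep_iff {A S : Finset (γ × Fin 3)} :
    (Z.restrict A).Indep S ↔ IsSubtransversal (restrictClasses Z.classes A) S ∧ Z.Indep S := by
  classical
  have hr : ∀ S, (Z.restrict A).rank S =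
    if IsSubtransversal (restrictClasses Z.classes A) S then Z.rank S else 0 := fun _ => rfl
  have hc : (Z.restrict A).classes = restrictClasses Z.classes A := rfl
  unfold Indep
  rw [hc, hr]
  refine and_congr_right fun h => ?_
  rw [if_pos h]
  exact ⟨fun h' => ⟨h.of_restrictClasses, h'⟩, fun h' => h'.2⟩

theorem Multimatroid.Represents.isBasis_restrict_iff (h : Represents id E t Z)
    (ht : IsBalanced E t) {B : Finset (γ × Fin 3)} :
    (Z.restrict (SetSystem.dotBar E)).IsBasis B ↔
      ∃ X ⊆ E, B = SetSystem.omega E X ∧ t (indicator X) = 1 := by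
  have hc : (Z.restrict (SetSystem.dotBar E)).classes =
      restrictClasses (namedClasses id E) (SetSystem.dotBar E) := by rw [← h.1]; rfl
  have h2 : ∀ c ∈ (Z.restrict (SetSystem.dotBar E)).classes, 2 ≤ c.card := by
    rw [hc, restrictClasses_dotBar]
    intro c hc
    obtain ⟨e, -, rfl⟩ := Finset.mem_image.1 hc
    rw [Finset.card_pair (by simp)]
  rw [Multimatroid.isBasis_iff h2, restrict_indep_iff, hc, h.1]
  constructor
  · rintro ⟨hT, hS, hB⟩
    have hT' : IsTransversal (namedClasses id E) B := by
      refine ⟨hS.of_restrictClasses.1, fun c hc => le_antisymm (hS.of_restrictClasses.2 c hc) ?_⟩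
      obtain ⟨e, he, rfl⟩ := Finset.mem_image.1 hc
      rw [← hT.2 {(e, 0), (e, 1)} (by
        rw [restrictClasses_dotBar]
        exact Finset.mem_image_of_mem _ he), ← namedClass_inter_dotBar he]
      exact Finset.card_le_card (Finset.inter_subset_inter_left Finset.inter_subset_left)
    obtain ⟨w, rfl⟩ := exists_eq_trace_of_isTransversal injective_id hT'
    have hw : ∀ e ∈ E, w e = indicator (E.filter fun a => w a = 0) e := by
      intro e he
      have hm := (Finset.mem_inter.1 (subset_of_restrictClasses hT.1
        ((mem_trace_iff injective_id (p := id)).2 ⟨he, rfl⟩))).2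
      simp only [SetSystem.dotBar, id, Finset.mem_union, Finset.mem_image, Prod.mk.injEq] at hm
      rcases hm with ⟨b, -, rfl, h0⟩ | ⟨b, -, rfl, h1⟩
      · simp [indicator, he, ← h0]
      · simp [indicator, he, ← h1]
    refine ⟨E.filter fun a => w a = 0, Finset.filter_subset _ _, ?_, ?_⟩
    · rw [omega_eq_trace (Finset.filter_subset _ _)]
      exact trace_congr hw
    · rw [← ht.congr _ _ hw]
      exact (h.2 w).1 hB
  · rintro ⟨X, hX, rfl, h1⟩
    rw [omega_eq_trace hX]
    have hT : IsTransversal (restrictClasses (namedClasses id E) (SetSystem.dotBar E))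
        (trace id E (indicator X)) := by
      rw [restrictClasses_dotBar]
      have hmem : ∀ e, (e, indicator X e) ∈ ({(e, 0), (e, 1)} : Finset (γ × Fin 3)) := by
        intro e
        by_cases heX : e ∈ X <;> simp [indicator, heX]
      refine ⟨fun x hx => ?_, fun c hc => ?_⟩
      · obtain ⟨e, he, rfl⟩ := mem_trace.1 hx
        exact Finset.mem_biUnion.2 ⟨_, Finset.mem_image_of_mem _ he, hmem e⟩
      · obtain ⟨e, he, rfl⟩ := Finset.mem_image.1 hc
        rw [Finset.card_eq_one]
        refine ⟨(e, indicator X e), ?_⟩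
        ext x
        rw [Finset.mem_inter, Finset.mem_singleton]
        constructor
        · rintro ⟨hx, hxe⟩
          have hx' : x ∈ trace id E (indicator X) ∩ namedClass id e := by
            refine Finset.mem_inter.2 ⟨hx, ?_⟩
            rw [← namedClass_inter_dotBar he] at hxe
            exact (Finset.mem_inter.1 hxe).1
          rw [trace_inter_namedClass injective_id he] at hx'
          exact Finset.mem_singleton.1 hx'
        · rintro rfl
          exact ⟨mem_trace.2 ⟨e, he, rfl⟩, hmem e⟩
    exact ⟨hT, hT.isSubtransversal, (h.2 _).2 h1⟩

theorem omega_injOn {X Y : Finset γ} (hX : X ⊆ E) (hY : Y ⊆ E)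
    (h : SetSystem.omega E X = SetSystem.omega E Y) : X = Y := by
  rw [omega_eq_trace hX, omega_eq_trace hY] at h
  have h' := ((trace_subset_trace_iff injective_id).1 h.le).2
  ext a
  by_cases ha : a ∈ E
  · have := h' a ha
    by_cases haX : a ∈ X <;> by_cases haY : a ∈ Y <;> simp_all [indicator]
  · exact ⟨fun h => absurd (hX h) ha, fun h => absurd (hY h) ha⟩

theorem Multimatroid.Represents.isBasis_restrict_omega_iff (h : Represents id E t Z)
    (ht : IsBalanced E t) {X : Finset γ} (hX : X ⊆ E) :
    (Z.restrict (SetSystem.dotBar E)).IsBasis (SetSystem.omega E X) ↔ t (indicator X) = 1 := by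
  rw [h.isBasis_restrict_iff ht]
  constructor
  · rintro ⟨Y, hY, hXY, h1⟩
    rwa [omega_injOn hX hY hXY]
  · exact fun h1 => ⟨X, hX, rfl, h1⟩

theorem SetSystem.Encodes.isTightThreeMatroidOf_iff {D : SetSystem γ} (h : Encodes t D)
    (ht : IsTightTensor D.ground t) :
    D.IsTightThreeMatroidOf Z ↔ Represents id D.ground t Z := by
  unfold IsTightThreeMatroidOf IsTwoMatroidOf
  rw [← namedClasses_id]
  constructor
  · rintro ⟨hc, hZ, -, hB⟩
    have hr := represents_toTensor hc
    have ht' := isTightTensor_toTensor injective_id hc hZ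
    have henc : Encodes (toTensor id D.ground Z) D := by
      refine ⟨ht'.toIsBalanced, fun X => ?_⟩
      constructor
      · intro hX
        have hXs := D.subset_ground X hX
        exact ⟨hXs, (hr.isBasis_restrict_omega_iff ht'.toIsBalanced hXs).1
          ((hB _).2 ⟨X, hX, rfl⟩)⟩
      · rintro ⟨hXs, h1⟩
        obtain ⟨Y, hY, hXY⟩ :=
          (hB _).1 ((hr.isBasis_restrict_omega_iff ht'.toIsBalanced hXs).2 h1)
        rwa [omega_injOn hXs (D.subset_ground Y hY) hXY]
    rwa [h.tensor_unique henc]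
  · intro hr
    refine ⟨hr.1, hr.isTight injective_id ht, ?_, fun B => ?_⟩
    · rw [← restrictClasses_dotBar, ← hr.1]
      rfl
    · rw [hr.isBasis_restrict_iff ht.toIsBalanced]
      constructor
      · rintro ⟨X, hX, rfl, h1⟩
        exact ⟨X, (h.2 X).2 ⟨hX, h1⟩, rfl⟩
      · rintro ⟨X, hX, rfl⟩
        exact ⟨X, D.subset_ground X hX, rfl, ((h.2 X).1 hX).2⟩

theorem Multimatroid.Represents.ofThreeMatroid (h : Represents id E t Z) (ht : IsBalanced E t) :
    (SetSystem.ofThreeMatroid Z).ground = E ∧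
      SetSystem.Encodes t (SetSystem.ofThreeMatroid Z) := by
  have hg : Z.ground.image Prod.fst = E := by
    ext a
    have hmem : ∀ x, x ∈ Z.ground ↔ ∃ e ∈ E, ∃ k, (e, k) = x := fun x => by
      unfold ground
      rw [h.1]
      exact mem_carrierGround_namedClasses
    simp only [Finset.mem_image, hmem]
    constructor
    · rintro ⟨_, ⟨e, he, k, rfl⟩, rfl⟩
      exact he
    · intro ha
      exact ⟨(a, 0), ⟨a, ha, 0, rfl⟩, rfl⟩
  have hg' : (SetSystem.ofThreeMatroid Z).ground = E := hg
  refine ⟨hg', hg' ▸ ht, fun X => ?_⟩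
  have hf : X ∈ (SetSystem.ofThreeMatroid Z).feasible ↔ X ⊆ Z.ground.image Prod.fst ∧
    (Z.restrict (SetSystem.dotBar (Z.ground.image Prod.fst))).IsBasis
      (SetSystem.omega (Z.ground.image Prod.fst) X) := Iff.rfl
  rw [hf, hg', hg]
  exact and_congr_right fun hX => h.isBasis_restrict_omega_iff ht hX

end ThreeMatroid

/-! ### 2-sums -/

namespace Multimatroid

open Function

variable {γ δ : Type*} [DecidableEq γ] [DecidableEq δ] {p : γ × Fin 3 → δ} {E E₁ E₂ : Finset γ}
  {t t₁ t₂ : (γ → Fin 3) → ZMod 2} {Z Z₁ Z₂ : Multimatroid δ} {e f : γ}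

theorem Represents.isNonsingularOrderedClass_iff {γ : Type*} {p : γ × Fin 3 → δ} {E : Finset γ}
    {t : (γ → Fin 3) → ZMod 2} {e : γ} (hp : Injective p) (h : Represents p E t Z)
    (he : e ∈ E) :
    Z.IsNonsingularOrderedClass (fun k => p (e, k)) ↔ IsNonsingularAt t e := by
  have hrank : ∀ k, Z.rank {p (e, k)} ≠ 0 ↔ ∃ w, w e = k ∧ t w = 1 := by
    intro k
    have htr : ({p (e, k)} : Finset δ) = trace p {e} fun _ => k := by simp [trace]
    have hE : ({e} : Finset γ) ⊆ E := by simpa using he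
    have hs : IsSubtransversal Z.classes {p (e, k)} := by
      rw [htr, h.1]; exact isSubtransversal_trace hp hE
    have h1 := rank_le_card hs
    rw [Finset.card_singleton] at h1
    have h2 : Z.Indep {p (e, k)} ↔ Z.rank {p (e, k)} ≠ 0 := by
      unfold Indep
      rw [Finset.card_singleton]
      constructor
      · rintro ⟨-, h3⟩; omega
      · intro h3; exact ⟨hs, by omega⟩
    rw [← h2, htr, h.indep_trace_iff hp hE]
    simp [and_comm]
  unfold IsNonsingularOrderedClass IsSingularClass
  have hinj : Injective fun k => p (e, k) := fun _ _ h => (Prod.mk.inj (hp h)).2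
  have hmem : Finset.univ.image (fun k => p (e, k)) ∈ Z.classes := by
    rw [h.1]; exact (namedClass_mem_namedClasses hp).2 he
  simp only [hinj, hmem, true_and, IsNonsingularAt]
  simp only [Finset.mem_image, Finset.mem_univ, true_and, exists_exists_eq_and, not_exists]
  exact forall_congr' hrank

theorem Represents.indep_trace_erase_iff (hp : Injective p) (h : Represents p E t Z)
    (ht : IsBalanced E t) {w : γ → Fin 3} :
    Z.Indep (trace p (E.erase e) w) ↔ ∃ k, t (update w e k) = 1 := by
  rw [h.indep_trace_iff hp (Finset.erase_subset _ _)]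
  constructor
  · rintro ⟨w', hw', heq⟩
    refine ⟨w' e, ?_⟩
    rw [← hw']
    refine ht.congr _ _ fun a ha => ?_
    by_cases hae : a = e
    · subst hae; simp
    · rw [update_of_ne hae, heq a (Finset.mem_erase.2 ⟨hae, ha⟩)]
  · rintro ⟨k, hk⟩
    exact ⟨_, hk, fun a ha => update_of_ne (Finset.ne_of_mem_erase ha) _ _⟩

theorem Represents.isSlack_iff (hp : Injective p) (h : Represents p E t Z) (he : e ∈ E)
    {w : γ → Fin 3} (hi : Z.Indep (trace p (E.erase e) w)) (k : Fin 3) :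
    Z.IsSlack (trace p (E.erase e) w) (p (e, k)) ↔ t (update w e k) = 0 := by
  have hce : namedClass p e ∈ Z.classes := by
    rw [h.1]; exact (namedClass_mem_namedClasses hp).2 he
  have hd : Disjoint (namedClass p e) (trace p (E.erase e) w) :=
    (disjoint_namedClass_trace_iff hp).2 (Finset.notMem_erase e E)
  have hk : p (e, k) ∈ namedClass p e := (mem_namedClass_iff hp).2 rfl
  have h1 := rank_insert_eq_iff_of_indep hi hce hd hk
  have h2 : ¬ Z.Indep (insert (p (e, k)) (trace p (E.erase e) w)) ↔ t (update w e k) = 0 := by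
    rw [insert_trace_erase he, h.2]
    rcases zmod_two_eq_zero_or_one (t (update w e k)) with h3 | h3 <;> simp [h3]
  rw [← h2, ← h1]
  refine ⟨fun hs => ?_, fun hr => ⟨?_, _, hce, hd, hk, hr⟩⟩
  · obtain ⟨-, c, -, -, -, hr⟩ := hs
    exact hr
  · rw [h.1]; exact isNearTransversal_trace_erase hp he

theorem trace_inter_carrierGround (hp : Injective p) {w : γ → Fin 3} :
    trace p E w ∩ carrierGround (namedClasses p E₁) = trace p (E ∩ E₁) w := by
  ext x
  rw [Finset.mem_inter, mem_carrierGround_namedClasses, mem_trace, mem_trace]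
  constructor
  · rintro ⟨⟨a, ha, rfl⟩, b, hb, k, hk⟩
    obtain ⟨rfl, -⟩ := Prod.mk.inj (hp hk)
    exact ⟨b, Finset.mem_inter.2 ⟨ha, hb⟩, rfl⟩
  · rintro ⟨a, ha, rfl⟩
    rw [Finset.mem_inter] at ha
    exact ⟨⟨a, ha.1, rfl⟩, a, ha.2, _, rfl⟩

theorem isTwoSum_iff (hp : Injective p) (ht₁ : IsTightTensor E₁ t₁) (ht₂ : IsTightTensor E₂ t₂)
    (hd : Disjoint E₁ E₂) (hf : f ∈ E₁) (he : e ∈ E₂) (hfns : IsNonsingularAt t₁ f)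
    (hens : IsNonsingularAt t₂ e) (h₁ : Represents p E₁ t₁ Z₁) (h₂ : Represents p E₂ t₂ Z₂) :
    IsTwoSum Z₁ (fun k => p (f, k)) Z₂ (fun k => p (e, k)) Z ↔
      Represents p (E₁.erase f ∪ E₂.erase e) (contract t₁ f t₂ e) Z := by
  have hfE₂ : f ∉ E₂ := Finset.disjoint_left.1 hd hf
  have heE₁ : e ∉ E₁ := Finset.disjoint_right.1 hd he
  have hE : E₁.erase f ∪ E₂.erase e = (E₁ ∪ E₂) \ {f, e} := by
    ext a
    simp only [Finset.mem_union, Finset.mem_erase, Finset.mem_sdiff, Finset.mem_insert,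
      Finset.mem_singleton]
    by_cases haf : a = f
    · subst haf; simp [hfE₂]
    · by_cases hae : a = e
      · subst hae; simp [heE₁]
      · simp [haf, hae]
  have hclasses : (Z₁.classes ∪ Z₂.classes) \ {Finset.univ.image fun k => p (f, k),
      Finset.univ.image fun k => p (e, k)} = namedClasses p (E₁.erase f ∪ E₂.erase e) := by
    rw [h₁.1, h₂.1, hE]
    unfold namedClasses
    rw [Finset.image_sdiff _ _ (namedClass_injective hp), Finset.image_union,
      Finset.image_insert, Finset.image_singleton]
    rfl
  have hinter₁ : (E₁.erase f ∪ E₂.erase e) ∩ E₁ = E₁.erase f := by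
    ext a
    have : a ∈ E₁ → a ∉ E₂ := fun h => Finset.disjoint_left.1 hd h
    simp only [Finset.mem_union, Finset.mem_erase, Finset.mem_inter]
    tauto
  have hinter₂ : (E₁.erase f ∪ E₂.erase e) ∩ E₂ = E₂.erase e := by
    ext a
    have : a ∈ E₁ → a ∉ E₂ := fun h => Finset.disjoint_left.1 hd h
    simp only [Finset.mem_union, Finset.mem_erase, Finset.mem_inter]
    tauto
  have hground : Disjoint Z₁.ground Z₂.ground := by
    unfold ground
    rw [h₁.1, h₂.1, Finset.disjoint_left]
    intro x hx hx'
    obtain ⟨a, ha, k, rfl⟩ := mem_carrierGround_namedClasses.1 hx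
    obtain ⟨b, hb, l, hl⟩ := mem_carrierGround_namedClasses.1 hx'
    obtain ⟨rfl, -⟩ := Prod.mk.inj (hp hl)
    exact Finset.disjoint_left.1 hd ha hb
  have hcond : ∀ w, (Z₁.Indep (trace p (E₁.erase f ∪ E₂.erase e) w ∩ Z₁.ground) ∧
      Z₂.Indep (trace p (E₁.erase f ∪ E₂.erase e) w ∩ Z₂.ground) ∧
      ∃ i j, i ≠ j ∧
        Z₁.IsSlack (trace p (E₁.erase f ∪ E₂.erase e) w ∩ Z₁.ground) (p (f, i)) ∧
        Z₂.IsSlack (trace p (E₁.erase f ∪ E₂.erase e) w ∩ Z₂.ground) (p (e, j))) ↔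
      contract t₁ f t₂ e w = 1 := by
    intro w
    unfold ground
    rw [h₁.1, h₂.1, trace_inter_carrierGround hp, trace_inter_carrierGround hp, hinter₁, hinter₂,
      contract_eq_one_iff ht₁.toIsBalanced ht₂.toIsBalanced hf he]
    rw [← h₁.indep_trace_erase_iff hp ht₁.toIsBalanced,
      ← h₂.indep_trace_erase_iff hp ht₂.toIsBalanced]
    refine and_congr_right fun hi₁ => and_congr_right fun hi₂ => ?_
    simp only [h₁.isSlack_iff hp hf hi₁, h₂.isSlack_iff hp he hi₂]
  constructor
  · rintro ⟨-, -, -, -, -, hc, hB⟩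
    rw [hclasses] at hc
    refine ⟨hc, fun w => ?_⟩
    have hT : IsTransversal Z.classes (trace p (E₁.erase f ∪ E₂.erase e) w) :=
      hc ▸ isTransversal_trace hp
    rw [← hcond, ← (hB _).trans (and_iff_right hT)]
    exact ⟨isBasis_of_isTransversal hT, fun h => h.1⟩
  · intro h
    refine ⟨h₁.isTight hp ht₁, h₂.isTight hp ht₂, hground,
      (h₁.isNonsingularOrderedClass_iff hp hf).2 hfns,
      (h₂.isNonsingularOrderedClass_iff hp he).2 hens, h.1.trans hclasses.symm, fun B => ?_⟩
    rw [h.isBasis_iff hp]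
    constructor
    · rintro ⟨w, rfl, hw⟩
      exact ⟨h.1 ▸ isTransversal_trace hp, (hcond w).2 hw⟩
    · rintro ⟨hT, hB⟩
      rw [h.1] at hT
      obtain ⟨w, rfl⟩ := exists_eq_trace_of_isTransversal hp hT
      exact ⟨w, rfl, (hcond w).1 hB⟩

end Multimatroid

namespace SetSystem

open Function

variable {γ γ' : Type*} [DecidableEq γ] [DecidableEq γ'] {t t₁ t₂ : (γ → Fin 3) → ZMod 2}
  {D D₁ D₂ : SetSystem γ} {e f : γ}

theorem isTwoSum_iff (ht₁ : IsTightTensor D₁.ground t₁) (ht₂ : IsTightTensor D₂.ground t₂)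
    (hd : Disjoint D₁.ground D₂.ground) (hf : f ∈ D₁.ground) (he : e ∈ D₂.ground)
    (hfns : IsNonsingularAt t₁ f) (hens : IsNonsingularAt t₂ e) (h₁ : Encodes t₁ D₁)
    (h₂ : Encodes t₂ D₂) :
    IsTwoSum D₁ f D₂ e D ↔
      D.ground = D₁.ground.erase f ∪ D₂.ground.erase e ∧ Encodes (contract t₁ f t₂ e) D := by
  have ht := ht₁.contract ht₂ hd hf he hens
  constructor
  · rintro ⟨-, -, -, -, -, Z₁, Z₂, Z, hZ₁, hZ₂, hZ, rfl⟩
    rw [h₁.isTightThreeMatroidOf_iff ht₁] at hZ₁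
    rw [h₂.isTightThreeMatroidOf_iff ht₂] at hZ₂
    exact ((Multimatroid.isTwoSum_iff injective_id ht₁ ht₂ hd hf he hfns hens hZ₁ hZ₂).1
      hZ).ofThreeMatroid ht.toIsBalanced
  · rintro ⟨hg, hD⟩
    have hr₁ := Multimatroid.represents_ofTensor injective_id ht₁
    have hr₂ := Multimatroid.represents_ofTensor injective_id ht₂
    have hr := Multimatroid.represents_ofTensor injective_id ht
    refine ⟨h₁.isVfSafe ht₁, h₂.isVfSafe ht₂, hd,
      ⟨hf, (h₁.not_isSingular_iff hf).2 hfns⟩,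
      ⟨he, (h₂.not_isSingular_iff he).2 hens⟩, _, _, _,
      (h₁.isTightThreeMatroidOf_iff ht₁).2 hr₁, (h₂.isTightThreeMatroidOf_iff ht₂).2 hr₂,
      (Multimatroid.isTwoSum_iff injective_id ht₁ ht₂ hd hf he hfns hens hr₁ hr₂).2 hr, ?_⟩
    obtain ⟨hg', hD'⟩ := hr.ofThreeMatroid ht.toIsBalanced
    exact hD.unique hD' (hg.trans hg'.symm)

theorem Encodes.map (h : Encodes t D) (ht : IsTightTensor D.ground t) (g : γ ↪ γ') :
    Encodes (fun w => t fun a => w (g a)) (D.map g) := by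
  refine ⟨(ht.map g).toIsBalanced, fun X => ?_⟩
  have hind : ∀ Y : Finset γ, (fun a => indicator (Y.map g) (g a)) = indicator Y := by
    intro Y
    funext a
    simp [indicator]
  constructor
  · rintro ⟨Y, hY, rfl⟩
    refine ⟨Finset.map_subset_map.2 (D.subset_ground Y hY), ?_⟩
    beta_reduce
    rw [hind]
    exact ((h.2 Y).1 hY).2
  · rintro ⟨hX, h1⟩
    obtain ⟨Y, hY, rfl⟩ := Finset.subset_map_iff.1 hX
    beta_reduce at h1
    rw [hind] at h1
    exact ⟨Y, (h.2 Y).2 ⟨hY, h1⟩, rfl⟩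

end SetSystem

/-! ### Tensor products -/

section TensorProduct

open Function

variable {α β : Type*} [DecidableEq α] [DecidableEq β]

/-- The index set after the 2-sum along `a` and the copy of `e`. -/
def stepGround (E₂ : Finset β) (e : β) (E : Finset (α ⊕ (α × β))) (a : α) :
    Finset (α ⊕ (α × β)) :=
  E.erase (Sum.inl a) ∪ (E₂.map (SetSystem.copyEmbedding a)).erase (SetSystem.copyEmbedding a e)

/-- The tensor after the 2-sum along `a` and the copy of `e`. -/
def stepTensor (t₂ : (β → Fin 3) → ZMod 2) (e : β) (t : (α ⊕ (α × β) → Fin 3) → ZMod 2) (a : α) :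
    (α ⊕ (α × β) → Fin 3) → ZMod 2 :=
  contract t (Sum.inl a) (fun w => t₂ fun b => w (SetSystem.copyEmbedding a b))
    (SetSystem.copyEmbedding a e)

theorem copyEmbedding_apply {α β : Type*} (a : α) (b : β) :
    SetSystem.copyEmbedding a b = Sum.inr (a, b) := rfl

instance stepGround_rightCommutative (E₂ : Finset β) (e : β) :
    RightCommutative (stepGround (α := α) E₂ e) where
  right_comm := by
    intro E a a'
    ext x
    simp only [stepGround, Finset.mem_union, Finset.mem_erase, Finset.mem_map, copyEmbedding_apply]
    rcases x with x | ⟨x, y⟩ <;> simp <;> tauto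

instance stepTensor_rightCommutative (t₂ : (β → Fin 3) → ZMod 2) (e : β) :
    RightCommutative (stepTensor (α := α) t₂ e) where
  right_comm := by
    intro t a a'
    by_cases haa : a = a'
    · rw [haa]
    · funext w
      have h1 : ∀ (b : α) (w : α ⊕ (α × β) → Fin 3) (a : α) k,
          (fun c => update w (Sum.inl a) k (SetSystem.copyEmbedding b c)) =
            fun c => w (SetSystem.copyEmbedding b c) := fun b w a k => by
        funext c
        simp [copyEmbedding_apply]
      have h2 : ∀ (b : α) (w : α ⊕ (α × β) → Fin 3) k l m,
          (fun c => update (update w (Sum.inl m) k) (SetSystem.copyEmbedding b e) l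
            (SetSystem.copyEmbedding b c)) =
          fun c => update w (SetSystem.copyEmbedding b e) l (SetSystem.copyEmbedding b c) := by
        intro b w k l m
        funext c
        simp [update_apply, copyEmbedding_apply]
      have hne : (Sum.inl a : α ⊕ (α × β)) ≠ Sum.inl a' := fun h => haa (Sum.inl_injective h)
      simp only [stepTensor, contract, h2, update_comm hne]
      ring

/-- The situation in which 2-sums along the elements of `l` can be formed. -/
structure IsChainStart (l : List α) (E : Finset (α ⊕ (α × β)))
    (t : (α ⊕ (α × β) → Fin 3) → ZMod 2) : Prop where
  tight : IsTightTensor E t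
  nodup : l.Nodup
  mem : ∀ a ∈ l, Sum.inl a ∈ E
  nonsingular : ∀ a ∈ l, IsNonsingularAt t (Sum.inl a)
  notMem : ∀ a ∈ l, ∀ b, Sum.inr (a, b) ∉ E

namespace IsChainStart

variable {E₂ : Finset β} {t₂ : (β → Fin 3) → ZMod 2} {e : β} {a : α} {l : List α}
  {E : Finset (α ⊕ (α × β))} {t : (α ⊕ (α × β) → Fin 3) → ZMod 2}

theorem disjoint (h : IsChainStart (a :: l) E t) :
    Disjoint E (E₂.map (SetSystem.copyEmbedding a)) := by
  rw [Finset.disjoint_right]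
  intro x hx
  obtain ⟨b, -, rfl⟩ := Finset.mem_map.1 hx
  exact h.notMem a (by simp) b

theorem step (ht₂ : IsTightTensor E₂ t₂) (he : e ∈ E₂) (hens : IsNonsingularAt t₂ e)
    (h : IsChainStart (a :: l) E t) :
    IsChainStart l (stepGround E₂ e E a) (stepTensor t₂ e t a) where
  tight := h.tight.contract (ht₂.map _) h.disjoint (h.mem a (by simp))
    (Finset.mem_map_of_mem _ he) (hens.map _)
  nodup := (List.nodup_cons.1 h.nodup).2
  mem := by
    intro b hb
    have hba : b ≠ a := by rintro rfl; exact (List.nodup_cons.1 h.nodup).1 hb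
    exact Finset.mem_union_left _ (Finset.mem_erase.2
      ⟨fun heq => hba (Sum.inl_injective heq), h.mem b (by simp [hb])⟩)
  nonsingular := fun b hb => IsNonsingularAt.contract h.tight (ht₂.map _) h.disjoint
    (h.mem a (by simp)) (Finset.mem_map_of_mem _ he) (hens.map _) (h.mem b (by simp [hb]))
    (h.nonsingular b (by simp [hb]))
  notMem := by
    intro b hb c hc
    have hba : b ≠ a := by rintro rfl; exact (List.nodup_cons.1 h.nodup).1 hb
    rcases Finset.mem_union.1 hc with hc | hc
    · exact h.notMem b (by simp [hb]) c (Finset.mem_of_mem_erase hc)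
    · obtain ⟨d, -, hd⟩ := Finset.mem_map.1 (Finset.mem_of_mem_erase hc)
      exact hba (Prod.mk.inj (Sum.inr_injective hd)).1.symm

theorem foldl (ht₂ : IsTightTensor E₂ t₂) (he : e ∈ E₂) (hens : IsNonsingularAt t₂ e)
    (h : IsChainStart l E t) :
    IsTightTensor (l.foldl (stepGround E₂ e) E) (l.foldl (stepTensor t₂ e) t) := by
  induction l generalizing E t with
  | nil => exact h.tight
  | cons a l ih => exact ih (h.step ht₂ he hens)

end IsChainStart

theorem naturalIdentification_injective {α β : Type*} :
    Injective (naturalIdentification : (α ⊕ (α × β)) × Fin 3 → _) := by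
  rintro ⟨a | ⟨a, b⟩, i⟩ ⟨a' | ⟨a', b'⟩, i'⟩ h <;>
    simp_all [naturalIdentification]

theorem Multimatroid.isTensorChain_iff {E₂ : Finset β} {t₂ : (β → Fin 3) → ZMod 2} {e : β}
    {Z₂ : Multimatroid (β × Fin 3)} (ht₂ : IsTightTensor E₂ t₂) (he : e ∈ E₂)
    (hens : IsNonsingularAt t₂ e) (h₂ : Represents id E₂ t₂ Z₂) {l : List α}
    {E : Finset (α ⊕ (α × β))} {t : (α ⊕ (α × β) → Fin 3) → ZMod 2}
    {W Z : Multimatroid ((α × Fin 3) ⊕ (α × (β × Fin 3)))} (h : IsChainStart l E t)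
    (hW : Represents naturalIdentification E t W) :
    IsTensorChain (fun a k => (a, k)) Z₂ (fun k => (e, k)) l W Z ↔
      Represents naturalIdentification (l.foldl (stepGround E₂ e) E)
        (l.foldl (stepTensor t₂ e) t) Z := by
  have hinj := naturalIdentification_injective (α := α) (β := β)
  induction l generalizing E t W with
  | nil =>
    constructor
    · rintro ⟨⟩
      exact hW
    · intro hZ
      rw [← hW.unique hinj hZ]
      exact IsTensorChain.nil W
  | cons a l ih =>
    have hpq : ∀ b k, (Sum.inr (a, id (b, k)) : (α × Fin 3) ⊕ (α × (β × Fin 3))) =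
        naturalIdentification (SetSystem.copyEmbedding a b, k) := fun _ _ => rfl
    have hsum : ∀ {C W' : Multimatroid ((α × Fin 3) ⊕ (α × (β × Fin 3)))},
        Represents naturalIdentification (E₂.map (SetSystem.copyEmbedding a))
          (fun w => t₂ fun b => w (SetSystem.copyEmbedding a b)) C →
        (IsTwoSum W (fun k => Sum.inl (a, k)) C (fun k => Sum.inr (a, (e, k))) W' ↔
          Represents naturalIdentification (stepGround E₂ e E a) (stepTensor t₂ e t a) W') :=
      fun hC => Multimatroid.isTwoSum_iff hinj h.tight (ht₂.map _) h.disjoint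
        (h.mem a (by simp)) (Finset.mem_map_of_mem _ he) (h.nonsingular a (by simp))
        (hens.map _) hW hC
    have hstep := h.step ht₂ he hens
    rw [List.foldl_cons, List.foldl_cons]
    constructor
    · rintro ⟨⟩
      rename_i C W' hC hW' hZ
      have hC' := hC.represents (g := SetSystem.copyEmbedding a) injective_id hinj hpq h₂
      exact (ih hstep ((hsum hC').1 hW')).1 hZ
    · intro hZ
      have hC := represents_ofTensor hinj (ht₂.map (SetSystem.copyEmbedding a))
      have hW' := represents_ofTensor hinj hstep.tight
      exact IsTensorChain.cons a l W _ _ Z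
        (h₂.isIsoVia (g := SetSystem.copyEmbedding a) injective_id hinj hpq hC)
        ((hsum hC).2 hW') ((ih hstep hW').2 hZ)

/-- The set system encoded by `t`. -/
def SetSystem.ofTensor {γ : Type*} [DecidableEq γ] (E : Finset γ) (t : (γ → Fin 3) → ZMod 2) :
    SetSystem γ where
  ground := E
  feasible := {X | X ⊆ E ∧ t (indicator X) = 1}
  subset_ground := fun _ hX => hX.1

theorem SetSystem.encodes_ofTensor {γ : Type*} [DecidableEq γ] {E : Finset γ}
    {t : (γ → Fin 3) → ZMod 2} (h : IsBalanced E t) : Encodes t (ofTensor E t) :=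
  ⟨h, fun _ => Iff.rfl⟩

theorem SetSystem.isTensorChain_iff {D₂ : SetSystem β} {t₂ : (β → Fin 3) → ZMod 2} {e : β}
    (ht₂ : IsTightTensor D₂.ground t₂) (he : e ∈ D₂.ground)
    (hens : IsNonsingularAt t₂ e) (h₂ : Encodes t₂ D₂) {l : List α}
    {t : (α ⊕ (α × β) → Fin 3) → ZMod 2} {W D : SetSystem (α ⊕ (α × β))}
    (h : IsChainStart l W.ground t) (hW : Encodes t W) :
    IsTensorChain D₂ e l W D ↔ D.ground = l.foldl (stepGround D₂.ground e) W.ground ∧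
      Encodes (l.foldl (stepTensor t₂ e) t) D := by
  induction l generalizing t W with
  | nil =>
    constructor
    · rintro ⟨⟩
      exact ⟨rfl, hW⟩
    · rintro ⟨hg, hD⟩
      rw [hD.unique hW hg]
      exact IsTensorChain.nil W
  | cons a l ih =>
    have hsum : ∀ {W'}, IsTwoSum W (Sum.inl a) (D₂.map (copyEmbedding a)) (Sum.inr (a, e)) W' ↔
        W'.ground = stepGround D₂.ground e W.ground a ∧ Encodes (stepTensor t₂ e t a) W' :=
      fun {W'} => SetSystem.isTwoSum_iff h.tight (ht₂.map (copyEmbedding a)) h.disjoint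
        (h.mem a (by simp)) (Finset.mem_map_of_mem _ he) (h.nonsingular a (by simp))
        (hens.map (copyEmbedding a)) hW (h₂.map ht₂ _)
    have hstep := h.step ht₂ he hens
    rw [List.foldl_cons, List.foldl_cons]
    constructor
    · rintro ⟨⟩
      rename_i W' hW' hD
      obtain ⟨hg, henc⟩ := hsum.1 hW'
      rw [← hg] at hstep ⊢
      exact (ih hstep henc).1 hD
    · intro hD
      have henc := encodes_ofTensor hstep.tight.toIsBalanced
      exact IsTensorChain.cons a l W _ D (hsum.2 ⟨rfl, henc⟩) ((ih hstep henc).2 hD)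

end TensorProduct

theorem proposition5p2 {α β : Type*} [DecidableEq α] [DecidableEq β]
    (D₁ : SetSystem α) (D₂ : SetSystem β) (e : β)
    (hD₁ : D₁.IsVfSafe) (hD₁ns : ∀ f ∈ D₁.ground, ¬ D₁.IsSingular f)
    (hD₂ : D₂.IsVfSafe) (he : e ∈ D₂.ground) (hens : ¬ D₂.IsSingular e) :
    ∃ (Z₁ : Multimatroid (α × Fin 3)) (Z₂ : Multimatroid (β × Fin 3))
      (D : SetSystem (α ⊕ (α × β)))
      (Z : Multimatroid ((α × Fin 3) ⊕ (α × (β × Fin 3))))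
      (Z' : Multimatroid ((α ⊕ (α × β)) × Fin 3)),
      -- `Z₁` and `Z₂` are the tight 3-matroids of `D₁` and `D₂`
      (∀ W, D₁.IsTightThreeMatroidOf W ↔ W = Z₁) ∧
      (∀ W, D₂.IsTightThreeMatroidOf W ↔ W = Z₂) ∧
      -- `D` is the tensor product of `D₁` and `D₂` along `e`, and `Z'` is its tight 3-matroid
      (∀ W, SetSystem.IsTensorProduct D₁ D₂ e W ↔ W = D) ∧
      D.IsVfSafe ∧
      (∀ W, D.IsTightThreeMatroidOf W ↔ W = Z') ∧
      -- `Z` is the tensor product of `Z₁` and `Z₂` along the skew class of `e`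
      (∀ W, Multimatroid.IsTensorProduct Z₁ D₁.ground (fun a k => (a, k)) Z₂ (fun k => (e, k)) W ↔
        W = Z) ∧
      -- and the natural identification of elements is an isomorphism
      Multimatroid.IsIsoVia naturalIdentification Z' Z := by
  obtain ⟨t₁, h₁⟩ := D₁.exists_encodes
  obtain ⟨t₂, h₂⟩ := D₂.exists_encodes
  have ht₁ := hD₁.isTightTensor h₁
  have ht₂ := hD₂.isTightTensor h₂
  have hens' := (h₂.not_isSingular_iff he).1 hens
  have hns₁ : ∀ a ∈ D₁.ground, IsNonsingularAt t₁ a := fun a ha =>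
    (h₁.not_isSingular_iff ha).1 (hD₁ns a ha)
  have hinj := naturalIdentification_injective (α := α) (β := β)
  have hZ₁ := Multimatroid.represents_ofTensor (p := id) Function.injective_id ht₁
  have hZ₂ := Multimatroid.represents_ofTensor (p := id) Function.injective_id ht₂
  set inl : α ↪ α ⊕ (α × β) := Function.Embedding.inl with hinl
  have hstart : ∀ l : List α, l.Nodup → l.toFinset = D₁.ground →
      IsChainStart l (D₁.ground.map inl) fun w => t₁ fun a => w (inl a) := by
    intro l hl hlD
    have hmem : ∀ a ∈ l, a ∈ D₁.ground := fun a ha => by rw [← hlD]; simpa using ha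
    exact ⟨ht₁.map inl, hl, fun a ha => Finset.mem_map_of_mem inl (hmem a ha),
      fun a ha => (hns₁ a (hmem a ha)).map inl, fun a _ b hb => by simp [hinl] at hb⟩
  have hnodup := D₁.ground.nodup_toList
  have htoList := D₁.ground.toList_toFinset
  have hperm : ∀ l : List α, l.Nodup → l.toFinset = D₁.ground → l.Perm D₁.ground.toList :=
    fun l hl hlD => List.perm_of_nodup_nodup_toFinset_eq hl hnodup (hlD.trans htoList.symm)
  set E := D₁.ground.toList.foldl (stepGround D₂.ground e) (D₁.ground.map inl)
  set t := D₁.ground.toList.foldl (stepTensor t₂ e) fun w => t₁ fun a => w (inl a)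
  have hfoldE : ∀ l : List α, l.Nodup → l.toFinset = D₁.ground →
      l.foldl (stepGround D₂.ground e) (D₁.ground.map inl) = E := fun l hl hlD =>
    (hperm l hl hlD).foldl_eq _
  have hfoldt : ∀ l : List α, l.Nodup → l.toFinset = D₁.ground →
      l.foldl (stepTensor t₂ e) (fun w => t₁ fun a => w (inl a)) = t := fun l hl hlD =>
    (hperm l hl hlD).foldl_eq _
  have ht : IsTightTensor E t := (hstart _ hnodup htoList).foldl ht₂ he hens'
  have hD := SetSystem.encodes_ofTensor ht.toIsBalanced
  have hZ' := Multimatroid.represents_ofTensor (p := id) Function.injective_id ht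
  have hZ := Multimatroid.represents_ofTensor hinj ht
  have hchain : ∀ l : List α, l.Nodup → l.toFinset = D₁.ground → ∀ W,
      SetSystem.IsTensorChain D₂ e l (D₁.map inl) W ↔ W = SetSystem.ofTensor E t := by
    intro l hl hlD W
    rw [SetSystem.isTensorChain_iff ht₂ he hens' h₂ (W := D₁.map inl) (hstart l hl hlD)
      (h₁.map ht₁ inl), hfoldt l hl hlD]
    have hg : (D₁.map inl).ground = D₁.ground.map inl := rfl
    rw [hg, hfoldE l hl hlD]
    constructor
    · rintro ⟨hWg, hW⟩
      exact hW.unique hD hWg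
    · rintro rfl
      exact ⟨rfl, hD⟩
  have hpq : ∀ a k, (Sum.inl (id (a, k)) : (α × Fin 3) ⊕ (α × (β × Fin 3))) =
      naturalIdentification (inl a, k) := fun _ _ => rfl
  refine ⟨Multimatroid.ofTensor id Function.injective_id _ _ ht₁,
    Multimatroid.ofTensor id Function.injective_id _ _ ht₂, SetSystem.ofTensor E t,
    Multimatroid.ofTensor _ hinj _ _ ht, Multimatroid.ofTensor id Function.injective_id _ _ ht,
    fun W => ?_, fun W => ?_, fun W => ?_, hD.isVfSafe ht, fun W => ?_, fun W => ?_,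
    Multimatroid.Represents.isIsoVia (g := Function.Embedding.refl _) Function.injective_id hinj
      (fun _ _ => rfl) hZ' ?_⟩
  · rw [h₁.isTightThreeMatroidOf_iff ht₁]
    exact ⟨fun h => h.unique Function.injective_id hZ₁, fun h => h ▸ hZ₁⟩
  · rw [h₂.isTightThreeMatroidOf_iff ht₂]
    exact ⟨fun h => h.unique Function.injective_id hZ₂, fun h => h ▸ hZ₂⟩
  · constructor
    · rintro ⟨-, -, -, -, h⟩
      exact (hchain _ hnodup htoList W).1 (h _ hnodup htoList)
    · rintro rfl
      exact ⟨hD₁, hD₂, hD₁ns, ⟨he, hens⟩, fun l hl hlD => (hchain l hl hlD _).2 rfl⟩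
  · rw [hD.isTightThreeMatroidOf_iff ht]
    exact ⟨fun h => h.unique Function.injective_id hZ', fun h => h ▸ hZ'⟩
  · constructor
    · rintro ⟨-, -, -, -, -, -, -, h⟩
      obtain ⟨W₀, hW₀, hW⟩ := h _ hnodup htoList
      have hr := hW₀.represents (g := inl) Function.injective_id hinj hpq hZ₁
      exact ((Multimatroid.isTensorChain_iff ht₂ he hens' hZ₂ (hstart _ hnodup htoList) hr).1
        hW).unique hinj hZ
    · rintro rfl
      have hr := Multimatroid.represents_ofTensor hinj (ht₁.map inl)
      refine ⟨by norm_num, hZ₁.isTight Function.injective_id ht₁,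
        hZ₂.isTight Function.injective_id ht₂,
        fun a ha => (hZ₁.isNonsingularOrderedClass_iff Function.injective_id ha).2 (hns₁ a ha),
        fun a _ b _ hab => namedClass_injective (p := id) Function.injective_id hab, rfl,
        (hZ₂.isNonsingularOrderedClass_iff Function.injective_id he).2 hens', fun l hl hlD =>
        ⟨_, hZ₁.isIsoVia (g := inl) Function.injective_id hinj hpq hr, ?_⟩⟩
      rw [Multimatroid.isTensorChain_iff ht₂ he hens' hZ₂ (hstart l hl hlD) hr,
        hfoldE l hl hlD, hfoldt l hl hlD]
      exact hZ
  · simpa using hZ
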